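/- **Setting.** Let $G=(V,E)$ be a finite nonempty strongly connected directed graph, $E\subseteq V\times V$. For $i\in V$ let $f_i:\mathbb R^m\to\mathbb R\cup\{\infty\}$ be closed proper convex and $\bar x_i\in\mathbb R^m$, and put $\bar m=\frac1{|V|}\sum_{i\in V}\bar x_i$. The primal problem is $$\min_{x\in\mathbb R^m}\ \sum_{i\in V}\Big[f_i(x)+\tfrac12\|x-\bar x_i\|^2\Big].\tag{P}$$ Let $I=V\cup E\cup\{r\}$ with an extra index $r$, and let $F$ be the set of unordered pairs $\{i,(i,j)\}$, $\{j,(i,j)\}$ for $(i,j)\in E$ and $\{r,\alpha\}$ for $\alpha\in V\cup E$. For $\mathbf x\in[\mathbb R^m]^{I}$ put $\mathbf f_i(\mathbf x)=f_i([\mathbf x]_i)$, and let $H_{\{\alpha_1,\alpha_2\}}=\{\mathbf x:[\mathbf x]_{\alpha_1}=[\mathbf x]_{\alpha_2}\}$. Write $g^*$ for the Fenchel conjugate of $g$ and $\delta_A$ for the indicator function of $A$. Weights $s=(s_\alpha)_{\alpha\in I}$ are admissible if $\sum_\alpha s_\alpha=|V|$, $s_\alpha>0$ for $\alpha\in V$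 and $s_\alpha\ge0$ for $\alpha\in E\cup\{r\}$. The dual problem with weights $s$ is $$\inf_{\mathbf z_\gamma\in[\mathbb R^m]^I,\ \gamma\in V\cup F}\ \sum_{i\in V}\mathbf f_i^*(\mathbf z_i)+\sum_{\beta\in F}\delta_{H_\beta^\perp}(\mathbf z_\beta)+\sum_{\alpha\in I}\frac{s_\alpha}2\Big\|\bar m-\frac1{s_\alpha}\Big[\sum_{\gamma\in V\cup F}\mathbf z_\gamma\Big]_\alpha\Big\|^2,\tag{D$_s$}$$ where the term of an index $\alpha$ with $s_\alpha=0$ is read as $\delta_{\{0\}}\big([\sum_\gamma\mathbf z_\gamma]_\alpha\big)$. **Algorithm.** The state consists of $y_i,z_i,\sigma_{i,y}\in\mathbb R^m$ and $s_i,\sigma_{i,s}\in\mathbb R$ for $i\in V$, and of $\rho_{e,y}\in\mathbb R^m$ and $\rho_{e,s}\in\mathbb R$ for $e\in E$. At the start $\sum_iy_i^0=|V|\bar m$, $s_i^0=1$, and all other quantities are $0$. Each iteration performs one of the following operations. * **A** at a node $i$: $y_i:=y_i/(\mathrm{outdeg}(i)+1)$ and $s_i:=s_i/(\mathrm{outdeg}(i)+1)$;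 then $\sigma_{i,y}:=\sigma_{i,y}+y_i$ and $\sigma_{i,s}:=\sigma_{i,s}+s_i$. * **B** on an edge $e=(i,j)$: $y_j:=y_j+\sigma_{i,y}-\rho_{e,y}$ and $s_j:=s_j+\sigma_{i,s}-\rho_{e,s}$; then $\rho_{e,y}:=\sigma_{i,y}$ and $\rho_{e,s}:=\sigma_{i,s}$. * **C** at a node $j$: with $x_{\rm temp}=\frac1{s_j}(y_j+z_j)$, replace $z_j$ by the minimizer of $\frac{s_j}2\|x_{\rm temp}-\frac1{s_j}z\|^2+f_j^*(z)$ over $z\in\mathbb R^m$; then $y_j:=s_jx_{\rm temp}-z_j$. The superscript $k$ denotes values after $k$ iterations. Put $s_{(i,j)}=\sigma_{i,s}-\rho_{(i,j),s}$, $y_{(i,j)}=\sigma_{i,y}-\rho_{(i,j),y}$, $s_r=0$, $y_r=0$, and $x_\alpha=y_\alpha/s_\alpha$ (irrelevant if $s_\alpha=0$). Let $\mathbf z_i^k$ have $i$-th component $z_i^k$ and all other components $0$. Call $(\mathbf z_\beta^k)_{\beta\in F}$ compatible if $\mathbf z^k_\beta\in H_\beta^\perp$ for all $\beta\in F$ and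 $\bar m-\frac1{s^k_\alpha}[\sum_{\gamma\in V\cup F}\mathbf z_\gamma^k]_\alpha=x_\alpha^k$ whenever $s_\alpha^k>0$. For such a choice let $T^k=(s^k,y^k,x^k,\mathbf z^k)$ and $$\mathrm{Val}(T^k)=\sum_{i\in V}\mathbf f_i^*(\mathbf z_i^k)+\sum_{\beta\in F}\delta_{H_\beta^\perp}(\mathbf z_\beta^k)+\sum_{\alpha\in V\cup E}\frac{s_\alpha^k}2\|x_\alpha^k\|^2\in\mathbb R\cup\{\infty\}.$$ **Theorem.** Suppose there is $\bar\epsilon>0$ with $s_i^k>\bar\epsilon$ for all $k\ge0$ and $i\in V$, the sequences $(z_i^k)_k$, $i\in V$, are bounded, and there is $K$ such that in any $K$ consecutive iterations operations A and C are performed at every node, and operation B on every edge, at least once. Then: 1. For every $k$ there is a compatible choice of $(\mathbf z^k_\beta)_{\beta\in F}$, even one with $\mathbf z^k_{\{r,\alpha\}}=0$ for all $\alpha\in V\cup E$. 2. For all compatible choices, $(\mathrm{Val}(T^k))_k$ is nonincreasing and converges to the optimal value of (D$_s$), for every choice of admissible weights $s$. 3. Problem (P) has a unique minimizer $x^*$,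 its value there is finite, and $x_i^k\to x^*$ as $k\to\infty$ for every $i\in V$. -/

import Mathlib

open Filter Topology

noncomputable section

namespace DualAscent

/-- The decision space `ℝ^m` with its Euclidean norm. -/
abbrev Vec (m : ℕ) : Type := EuclideanSpace ℝ (Fin m)

/-- The index set `V ∪ E ∪ {r}`; the extra index `r` is `none`. -/
abbrev Idx {V : Type*} (E : Finset (V × V)) : Type _ := Option (V ⊕ E)

/-- The index of a node. -/
abbrev node {V : Type*} {E : Finset (V × V)} (i : V) : Idx E := some (Sum.inl i)

/-- The index of an edge. -/
abbrev edge {V : Type*} {E : Finset (V × V)} (e : E) : Idx E := some (Sum.inr e)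

/-- The product space `[ℝ^m]^{V ∪ E ∪ {r}}` as an inner product space. -/
abbrev ProdSpace {V : Type*} (E : Finset (V × V)) (m : ℕ) : Type _ :=
  PiLp 2 (fun _ : Idx E => Vec m)

/-- The directed graph `(V, E)` is strongly connected. -/
def StronglyConnected {V : Type*} (E : Finset (V × V)) : Prop :=
  ∀ i j : V, Relation.ReflTransGen (fun a b => (a, b) ∈ E) i j

/-- Number of edges leaving `i`. -/
def outdeg {V : Type*} [DecidableEq V] (E : Finset (V × V)) (i : V) : ℕ :=
  (E.filter (fun e => e.1 = i)).card

/-! ### Convex analysis -/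

/-- Closed proper convex functions with values in `ℝ ∪ {∞}`. -/
structure IsClosedProperConvex {X : Type*} [TopologicalSpace X] [AddCommMonoid X] [Module ℝ X]
    (f : X → EReal) : Prop where
  ne_bot : ∀ x, f x ≠ ⊥
  proper : ∃ x, f x ≠ ⊤
  convex : Convex ℝ {p : X × ℝ | f p.1 ≤ (p.2 : EReal)}
  closed : LowerSemicontinuous f

/-- The Fenchel conjugate `f^*(z) = sup_x ⟨x, z⟩ - f(x)`. -/
def conj {X : Type*} [NormedAddCommGroup X] [InnerProductSpace ℝ X] (f : X → EReal) (z : X) :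
    EReal :=
  ⨆ x : X, ((inner ℝ x z : ℝ) : EReal) - f x

open Classical in
/-- The indicator function `δ_A`. -/
def indic {X : Type*} (A : Set X) (x : X) : EReal := if x ∈ A then 0 else ⊤

/-! ### The problems -/

section Problems

variable {V : Type*} [Fintype V] [DecidableEq V] {E : Finset (V × V)} {m : ℕ}

/-- The objective `∑ i, f_i(x) + ½‖x - x̄_i‖²` of the distributed optimization problem. -/
def primalObj (f : V → Vec m → EReal) (xbar : V → Vec m) (x : Vec m) : EReal :=
  ∑ i, (f i x + ((1 / 2 * ‖x - xbar i‖ ^ 2 : ℝ) : EReal))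

/-- The average `m̄` of the `x̄_i`. -/
def mean (xbar : V → Vec m) : Vec m := ((Fintype.card V : ℝ))⁻¹ • ∑ i, xbar i

/-- The lift `𝐟_i(𝐱) = f_i([𝐱]_i)` to the product space. -/
def lift (f : V → Vec m → EReal) (i : V) (x : ProdSpace E m) : EReal := f i (x (node i))

/-- The set `F` of unordered pairs `{i,(i,j)}`, `{j,(i,j)}` for `(i,j) ∈ E`, and `{r,α}` for
`α ∈ V ∪ E`. -/
def pairs (E : Finset (V × V)) : Finset (Sym2 (Idx E)) :=
  (Finset.univ.image (fun e : E => s(node e.1.1, edge e))) ∪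
  (Finset.univ.image (fun e : E => s(node e.1.2, edge e))) ∪
  (Finset.univ.image (fun a : V ⊕ E => s((none : Idx E), some a)))

/-- The subspace `H_{{α₁,α₂}} = {𝐱 : x_{α₁} = x_{α₂}}`. -/
def hyper (m : ℕ) (b : Sym2 (Idx E)) : Submodule ℝ (ProdSpace E m) where
  carrier := {x | ∀ a ∈ b, ∀ c ∈ b, x a = x c}
  add_mem' := by
    intro x y hx hy a ha c hc
    simp [hx a ha c hc, hy a ha c hc]
  zero_mem' := by
    intro a _ c _
    rfl
  smul_mem' := by
    intro t x hx a ha c hc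
    simp [hx a ha c hc]

/-- Admissible weights: `∑_α s_α = |V|`, `s_α > 0` on `V` and `s_α ≥ 0` on `E ∪ {r}`. -/
structure IsWeight (s : Idx E → ℝ) : Prop where
  sum_eq : ∑ a, s a = Fintype.card V
  node_pos : ∀ i : V, 0 < s (node i)
  nonneg : ∀ a, 0 ≤ s a

/-- The term `(s/2)‖m̄ - w/s‖²` of the dual objective. For `s = 0` it is, as the Fenchel conjugate
of the zero function, the indicator function of `{0}`. -/
def quad (s : ℝ) (mbar w : Vec m) : EReal :=
  if s = 0 then indic {0} w else ((s / 2 * ‖mbar - s⁻¹ • w‖ ^ 2 : ℝ) : EReal)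

/-- The objective of the dual problem (as a minimization problem) with weights `s`. The term of
the index `r` is kept: if `s_r = 0` it says `[∑ 𝐳]_r = 0`. -/
def dualObj (f : V → Vec m → EReal) (mbar : Vec m) (s : Idx E → ℝ)
    (z : V ⊕ pairs E → ProdSpace E m) : EReal :=
  ∑ i, conj (lift (E := E) f i) (z (Sum.inl i))
    + ∑ b : pairs E, indic ((hyper m b.1)ᗮ : Set (ProdSpace E m)) (z (Sum.inr b))
    + ∑ a, quad (s a) mbar ((∑ c, z c) a)

/-- The optimal value of the dual problem with weights `s`. -/
def dualValue (f : V → Vec m → EReal) (mbar : Vec m) (s : Idx E → ℝ) : EReal :=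
  ⨅ z : V ⊕ pairs E → ProdSpace E m, dualObj f mbar s z

/-- The tuple `T = (s, y, x, 𝐳)`. -/
structure Tuple (E : Finset (V × V)) (m : ℕ) where
  s : Idx E → ℝ
  y : Idx E → Vec m
  x : Idx E → Vec m
  z : V ⊕ pairs E → ProdSpace E m

/-- `Val(T)`. -/
def Val (f : V → Vec m → EReal) (T : Tuple E m) : EReal :=
  ∑ i, conj (lift (E := E) f i) (T.z (Sum.inl i))
    + ∑ b : pairs E, indic ((hyper m b.1)ᗮ : Set (ProdSpace E m)) (T.z (Sum.inr b))
    + ∑ a : V ⊕ E, ((T.s (some a) / 2 * ‖T.x (some a)‖ ^ 2 : ℝ) : EReal)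

end Problems

/-! ### The algorithm -/

section Algorithm

variable {V : Type*} [Fintype V] [DecidableEq V] {E : Finset (V × V)} {m : ℕ}

/-- The data kept by the algorithm; `z i` is `[𝐳_i]_i`. -/
structure State {V : Type*} (E : Finset (V × V)) (m : ℕ) where
  y : V → Vec m
  s : V → ℝ
  z : V → Vec m
  sigY : V → Vec m
  sigS : V → ℝ
  rhoY : E → Vec m
  rhoS : E → ℝ

/-- `s_α` for all indices, with `s_{(i,j)} = σ_{i,s} - ρ_{(i,j),s}` and `s_r = 0`. -/
def State.sAll (S : State E m) : Idx E → ℝ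
  | some (Sum.inl i) => S.s i
  | some (Sum.inr e) => S.sigS e.1.1 - S.rhoS e
  | none => 0

/-- `y_α` for all indices, with `y_{(i,j)} = σ_{i,y} - ρ_{(i,j),y}` and `y_r = 0`. -/
def State.yAll (S : State E m) : Idx E → Vec m
  | some (Sum.inl i) => S.y i
  | some (Sum.inr e) => S.sigY e.1.1 - S.rhoY e
  | none => 0

/-- `x_α = y_α / s_α` (the value is irrelevant where `s_α = 0`). -/
def State.xAll (S : State E m) (a : Idx E) : Vec m := (S.sAll a)⁻¹ • S.yAll a

/-- The tuple of a state, for a choice of the dual variables `𝐳_β`, `β ∈ F`; the dual variable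
`𝐳_i` of a node has the `i`-th component `[𝐳_i]_i` and all others zero. -/
def State.tuple (S : State E m) (zF : pairs E → ProdSpace E m) : Tuple E m where
  s := S.sAll
  y := S.yAll
  x := S.xAll
  z := Sum.elim (fun i => WithLp.toLp 2 (Pi.single (node i) (S.z i))) zF

/-- The dual variables `𝐳_β`, `β ∈ F`, fit the state: `𝐳_β ∈ H_β^⊥`, and
`m̄ - (1/s_α) [∑ 𝐳]_α = x_α` whenever `s_α > 0`. -/
structure Compatible (mbar : Vec m) (S : State E m) (zF : pairs E → ProdSpace E m) : Prop where
  mem_orthogonal : ∀ b, zF b ∈ (hyper m b.1)ᗮ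
  relation : ∀ a : Idx E, 0 < S.sAll a →
    mbar - (S.sAll a)⁻¹ • (∑ c, (S.tuple zF).z c) a = S.xAll a

/-- Starting states. -/
structure State.IsInitial (mbar : Vec m) (S : State E m) : Prop where
  y_sum : ∑ i, S.y i = (Fintype.card V : ℝ) • mbar
  s_eq : ∀ i, S.s i = 1
  z_eq : ∀ i, S.z i = 0
  sigY_eq : ∀ i, S.sigY i = 0
  sigS_eq : ∀ i, S.sigS i = 0
  rhoY_eq : ∀ e, S.rhoY e = 0
  rhoS_eq : ∀ e, S.rhoS e = 0

/-- The three operations with the node or edge they are applied to. -/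
inductive Op {V : Type*} (E : Finset (V × V)) where
  | A (i : V)
  | B (e : E)
  | C (j : V)

/-- Operation `A`: node `i` sends data. -/
def State.send (S : State E m) (i : V) : State E m :=
  let y' := ((outdeg E i : ℝ) + 1)⁻¹ • S.y i
  let s' := S.s i / ((outdeg E i : ℝ) + 1)
  { S with
    y := Function.update S.y i y'
    s := Function.update S.s i s'
    sigY := Function.update S.sigY i (S.sigY i + y')
    sigS := Function.update S.sigS i (S.sigS i + s') }

/-- Operation `B`: the end point of the edge `e` receives data along `e`. -/
def State.receive (S : State E m) (e : E) : State E m :=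
  { S with
    y := Function.update S.y e.1.2 (S.y e.1.2 + S.sigY e.1.1 - S.rhoY e)
    s := Function.update S.s e.1.2 (S.s e.1.2 + S.sigS e.1.1 - S.rhoS e)
    rhoY := Function.update S.rhoY e (S.sigY e.1.1)
    rhoS := Function.update S.rhoS e (S.sigS e.1.1) }

/-- The point `x_temp` of operation `C` at node `j`. -/
def State.xTemp (S : State E m) (j : V) : Vec m := (S.s j)⁻¹ • (S.y j + S.z j)

/-- The function that operation `C` minimizes at node `j`. -/
def State.proxObj (f : V → Vec m → EReal) (S : State E m) (j : V) (z : Vec m) : EReal :=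
  ((S.s j / 2 * ‖S.xTemp j - (S.s j)⁻¹ • z‖ ^ 2 : ℝ) : EReal) + conj (f j) z

/-- `S'` arises from `S` by the given operation. -/
def Step (f : V → Vec m → EReal) : Op E → State E m → State E m → Prop
  | .A i, S, S' => S' = S.send i
  | .B e, S, S' => S' = S.receive e
  | .C j, S, S' => ∃ z : Vec m, IsMinOn (S.proxObj f j) Set.univ z ∧
      S' = { S with
        z := Function.update S.z j z
        y := Function.update S.y j (S.s j • S.xTemp j - z) }

/-- A run of the algorithm: `S k` is the state after `k` iterations, and `op k` is the operation
that leads from `S k` to `S (k + 1)`. -/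
structure IsRun (f : V → Vec m → EReal) (mbar : Vec m) (op : ℕ → Op E) (S : ℕ → State E m) :
    Prop where
  init : (S 0).IsInitial mbar
  step : ∀ k, Step f (op k) (S k) (S (k + 1))

end Algorithm

end DualAscent

end

open DualAscent

open Filter Topology

/-! The method is block coordinate descent on the dual, and everything is read off one potential:
the sum of the conjugates at the `z i` plus `‖y‖² / (2s)` over nodes and edges (`realVal`, equal to
`Val` once finite). Operations A and B only merge weighted vectors, and convexity of `‖y‖² / s`
gives a decrease proportional to the squared disagreement of the merged points (`phi_merge`).
Operation C is an exact proximal step and decreases the potential by at least a multiple of the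
squared change of `z j` (`realVal_prox`). Total weight and `∑ y + ∑ z` are conserved (`State.Inv`).

Bounded `z` bounds the potential below, so its decreases tend to zero. Hence the points `x_i` move
by vanishing amounts. As every operation recurs within `K` iterations, disagreements along edges
vanish, and strong connectivity gives consensus (`tendsto_diff`). Conservation then forces `|V| (m̄
- x_j) - ∑ z_i → 0` (`tendsto_node_sub`), while each `z_i` is a subgradient of `f i` at a recent
`x_i` (`exists_subgrad_seq`).

A cluster point of the `z_i` therefore yields `x` with subgradients `z_i` satisfying `∑ z_i = |V|
(m̄ - x)`, which are the optimality conditions of primal and dual (`dualValue_eq`,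
`isMinOn_primalObj_iff`). Along the chosen ultrafilter the potential tends to the optimal value,
hence so does the whole eventually monotone sequence. Finally the gap to the optimal value dominates
`ε / 2 * ‖x_i - x‖²` (`State.Inv.realVal_ge`), so all the `x_i` converge, not just along the
ultrafilter.

The weights `s` enter the duality argument only through their sum, so the dual value is the same for
all admissible weights. Compatible `𝐳_β` exist because, on a connected graph, the spaces `H_β^⊥`
span all vectors with component sum zero. -/

namespace DualAscent

/-! ### Conjugates, subgradients and proximal points of extended-valued convex functions -/

section ConvexAnalysis

variable {X : Type*} [NormedAddCommGroup X] [InnerProductSpace ℝ X] {f : X → EReal}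

/-- `z` is a subgradient of `f` at the point `p` of its domain. -/
def IsSubgrad (f : X → EReal) (p z : X) : Prop :=
  ∃ r : ℝ, f p = r ∧ ∀ x, ((r + inner ℝ z (x - p) : ℝ) : EReal) ≤ f x

theorem IsClosedProperConvex.exists_real (hf : IsClosedProperConvex f) :
    ∃ (x : X) (c : ℝ), f x = c := by
  obtain ⟨x, hx⟩ := hf.proper
  exact ⟨x, (f x).toReal, (EReal.coe_toReal hx (hf.ne_bot x)).symm⟩

theorem IsClosedProperConvex.le_combo (hf : IsClosedProperConvex f) {x y : X} {a b t : ℝ}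
    (hx : f x ≤ a) (hy : f y ≤ b) (h0 : 0 ≤ t) (h1 : t ≤ 1) :
    f (x + t • (y - x)) ≤ (((1 - t) * a + t * b : ℝ) : EReal) := by
  have h := hf.convex (x := (x, a)) hx (y := (y, b)) hy (a := 1 - t) (b := t) (by linarith) h0
    (by ring)
  have e : x + t • (y - x) = (1 - t) • x + t • y := by
    rw [smul_sub, sub_smul, one_smul]; abel
  rw [e]
  simpa using h

theorem le_conj {x z : X} {r : ℝ} (hx : f x = r) : ((inner ℝ x z - r : ℝ) : EReal) ≤ conj f z := by
  refine le_trans (le_of_eq ?_) (le_iSup (fun x : X => ((inner ℝ x z : ℝ) : EReal) - f x) x)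
  rw [hx, EReal.coe_sub]

theorem IsClosedProperConvex.conj_ne_bot (hf : IsClosedProperConvex f) (z : X) :
    conj f z ≠ ⊥ := by
  obtain ⟨x, c, hx⟩ := hf.exists_real
  exact ne_bot_of_le_ne_bot (EReal.coe_ne_bot _) (le_conj (z := z) hx)

/-- The equality case of the Fenchel–Young inequality: the subgradient inequality says that the
supremum defining the conjugate is attained at `p`. -/
theorem conj_eq_of_subgrad {p z : X} {r : ℝ} (hp : f p = r)
    (h : ∀ x, ((r + inner ℝ z (x - p) : ℝ) : EReal) ≤ f x) :
    conj f z = ((inner ℝ p z - r : ℝ) : EReal) := by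
  refine le_antisymm (iSup_le fun x => ?_) (le_conj hp)
  have hx := h x
  induction hfx : f x using EReal.rec with
  | bot => rw [hfx] at hx; simp at hx
  | top => simp
  | coe a =>
    rw [hfx] at hx
    rw [← EReal.coe_sub]
    rw [EReal.coe_le_coe_iff] at hx ⊢
    rw [inner_sub_right, real_inner_comm x z, real_inner_comm p z] at hx
    linarith

/-- A closed proper convex function is bounded below by an affine function of the norm. -/
theorem IsClosedProperConvex.exists_growth [ProperSpace X] (hf : IsClosedProperConvex f) :
    ∃ (x₀ : X) (c M : ℝ), 0 ≤ M ∧ f x₀ = c ∧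
      ∀ x, ((-(M * (1 + ‖x - x₀‖)) : ℝ) : EReal) ≤ f x := by
  obtain ⟨x₀, c, hc⟩ := hf.exists_real
  obtain ⟨q, -, hq⟩ := (hf.closed.lowerSemicontinuousOn (Metric.closedBall x₀ 1)).exists_isMinOn
    ⟨x₀, by simp⟩ (isCompact_closedBall x₀ 1)
  obtain ⟨b, hb⟩ : ∃ b : ℝ, (b : EReal) ≤ f q := by
    induction h : f q using EReal.rec with
    | bot => exact absurd h (hf.ne_bot q)
    | top => exact ⟨0, le_top⟩
    | coe a => exact ⟨a, le_rfl⟩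
  have hball : ∀ x, ‖x - x₀‖ ≤ 1 → (b : EReal) ≤ f x := fun x hx =>
    hb.trans (hq (by simpa [dist_eq_norm] using hx))
  refine ⟨x₀, c, |b| + |c|, by positivity, hc, fun x => ?_⟩
  by_cases hx : ‖x - x₀‖ ≤ 1
  · refine le_trans ?_ (hball x hx)
    rw [EReal.coe_le_coe_iff]
    nlinarith [neg_abs_le b, abs_nonneg b, abs_nonneg c, norm_nonneg (x - x₀)]
  · push Not at hx
    set ρ := ‖x - x₀‖ with hρ
    have hρ0 : 0 < ρ := by linarith
    induction hfx : f x using EReal.rec with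
    | bot => exact absurd hfx (hf.ne_bot x)
    | top => exact le_top
    -- Pull `x` back to the unit sphere around `x₀`, where `f` is at least `b`. Convexity on the
    -- segment from `x₀` to `x` turns this into a bound on `f x` that is linear in `ρ`.
    | coe a =>
      have h1 := hf.le_combo (x := x₀) (y := x) (t := ρ⁻¹) hc.le hfx.le (by positivity)
        (inv_le_one_of_one_le₀ hx.le)
      have h2 := hball (x₀ + ρ⁻¹ • (x - x₀)) (by
        rw [add_sub_cancel_left, norm_smul, Real.norm_of_nonneg (by positivity), ← hρ,
          inv_mul_cancel₀ hρ0.ne'])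
      have h3 := EReal.coe_le_coe_iff.1 (h2.trans h1)
      rw [EReal.coe_le_coe_iff]
      have h4 : ρ * b ≤ (ρ - 1) * c + a := by
        have := mul_le_mul_of_nonneg_left h3 hρ0.le
        have e : ρ * ((1 - ρ⁻¹) * c + ρ⁻¹ * a) = (ρ - 1) * c + a := by
          field_simp
        linarith
      nlinarith [neg_abs_le b, abs_nonneg b, abs_nonneg c, le_abs_self c, neg_abs_le c,
        mul_le_mul_of_nonneg_left (neg_abs_le b) hρ0.le,
        mul_le_mul_of_nonneg_left (le_abs_self c) (sub_nonneg.2 hx.le)]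

/-- The quadratic beats the at most linear decay of `f`, so a minimizer over a large closed ball,
which exists by lower semicontinuity and compactness, is global. -/
theorem IsClosedProperConvex.exists_isMinOn_prox [ProperSpace X] (hf : IsClosedProperConvex f)
    {s : ℝ} (hs : 0 < s) (u : X) :
    ∃ p, IsMinOn (fun x => f x + ((s / 2 * ‖x - u‖ ^ 2 : ℝ) : EReal)) Set.univ p := by
  obtain ⟨x₀, c, M, hM, hc, hgrow⟩ := hf.exists_growth
  have hlsc : LowerSemicontinuous (fun x => f x + ((s / 2 * ‖x - u‖ ^ 2 : ℝ) : EReal)) := by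
    refine LowerSemicontinuous.add' hf.closed ?_ ?_
    · apply Continuous.lowerSemicontinuous
      exact continuous_coe_real_ereal.comp (by fun_prop)
    · intro x
      exact EReal.continuousAt_add (Or.inr (EReal.coe_ne_bot _)) (Or.inr (EReal.coe_ne_top _))
  set d := ‖x₀ - u‖ with hd
  -- Chosen so that for `ρ ≥ R` the term `s / 2 * ρ ^ 2` absorbs the cross term `s * d * ρ`, the
  -- linear loss `M * (1 + ρ) ≤ 2 * M * ρ` and the value `c`.
  set R := 1 + 2 * (s * d + 2 * M + |c|) / s with hR
  have hR1 : 1 ≤ R := by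
    have : 0 ≤ 2 * (s * d + 2 * M + |c|) / s := by positivity
    linarith
  obtain ⟨p, hpR, hp⟩ := (hlsc.lowerSemicontinuousOn (Metric.closedBall x₀ R)).exists_isMinOn
    ⟨x₀, by simp; linarith⟩ (isCompact_closedBall x₀ R)
  refine ⟨p, fun x _ => ?_⟩
  by_cases hx : ‖x - x₀‖ ≤ R
  · exact hp (by simpa [dist_eq_norm] using hx)
  · push Not at hx
    have h0 := isMinOn_iff.1 hp x₀ (by simp; linarith)
    refine le_trans h0 ?_
    simp only [hc]
    refine le_trans ?_ (add_le_add_left (hgrow x) _)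
    rw [← EReal.coe_add, ← EReal.coe_add, EReal.coe_le_coe_iff, ← hd]
    set ρ := ‖x - x₀‖
    have hρd : ρ - d ≤ ‖x - u‖ := by
      have : ‖x - x₀‖ ≤ ‖x - u‖ + ‖x₀ - u‖ := by
        have := norm_sub_le (x - u) (x₀ - u)
        simpa using this
      linarith
    have hsR : s * R = s + 2 * (s * d + 2 * M + |c|) := by
      rw [hR]; field_simp
    have hd0 : 0 ≤ d := norm_nonneg _
    have hRd : d ≤ R := by
      have : s * d ≤ s * R := by rw [hsR]; nlinarith [abs_nonneg c, mul_nonneg hs.le hd0]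
      exact le_of_mul_le_mul_left this hs
    have hsq : (ρ - d) ^ 2 ≤ ‖x - u‖ ^ 2 := pow_le_pow_left₀ (by linarith) hρd 2
    have h1 : s / 2 * (ρ - d) ^ 2 ≤ s / 2 * ‖x - u‖ ^ 2 :=
      mul_le_mul_of_nonneg_left hsq (by positivity)
    have h2 : s * R * ρ ≤ s * ρ * ρ := by
      have := mul_le_mul_of_nonneg_left hx.le (show 0 ≤ s * ρ by positivity)
      linarith
    rw [hsR] at h2
    nlinarith [le_abs_self c, abs_nonneg c, mul_nonneg (abs_nonneg c) (by linarith : 0 ≤ ρ - 1),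
      mul_nonneg hM (by linarith : 0 ≤ ρ - 1)]

/-- First-order optimality of the proximal point: compare it with `p + t • (x - p)`, use convexity,
divide by `t` and let `t` decrease to zero. -/
theorem IsClosedProperConvex.exists_subgrad_prox [ProperSpace X] (hf : IsClosedProperConvex f)
    {s : ℝ} (hs : 0 < s) (u : X) : ∃ p, IsSubgrad f p (s • (u - p)) := by
  obtain ⟨p, hp⟩ := hf.exists_isMinOn_prox hs u
  obtain ⟨x₀, c, hc⟩ := hf.exists_real
  obtain ⟨r, hr⟩ : ∃ r : ℝ, f p = r := by
    induction h : f p using EReal.rec with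
    | bot => exact absurd h (hf.ne_bot p)
    | top =>
      have := hp (Set.mem_univ x₀)
      simp only [h, hc, Set.mem_ofPred_eq, EReal.top_add_coe, top_le_iff] at this
      rw [← EReal.coe_add] at this
      exact absurd this (EReal.coe_ne_top _)
    | coe a => exact ⟨a, rfl⟩
  refine ⟨p, r, hr, fun x => ?_⟩
  induction hfx : f x using EReal.rec with
  | bot => exact absurd hfx (hf.ne_bot x)
  | top => exact le_top
  | coe a =>
    rw [EReal.coe_le_coe_iff]
    have key : ∀ t : ℝ, 0 < t → t ≤ 1 →
        r - a ≤ s * inner ℝ (p - u) (x - p) + t * (s / 2 * ‖x - p‖ ^ 2) := by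
      intro t ht ht1
      have h1 := hf.le_combo (x := p) (y := x) hr.le hfx.le ht.le ht1
      have h2 := hp (Set.mem_univ (p + t • (x - p)))
      simp only [Set.mem_ofPred_eq, hr] at h2
      have h3 := h2.trans (add_le_add_left h1 _)
      rw [← EReal.coe_add, ← EReal.coe_add, EReal.coe_le_coe_iff] at h3
      have e : p + t • (x - p) - u = (p - u) + t • (x - p) := by abel
      rw [e, norm_add_sq_real, inner_smul_right, norm_smul, Real.norm_of_nonneg ht.le] at h3
      have h4 : t * (r - a) ≤ t * (s * inner ℝ (p - u) (x - p) + t * (s / 2 * ‖x - p‖ ^ 2)) := by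
        nlinarith
      exact le_of_mul_le_mul_left h4 ht
    have hlim : Tendsto (fun t : ℝ => s * inner ℝ (p - u) (x - p) + t * (s / 2 * ‖x - p‖ ^ 2))
        (𝓝[>] 0) (𝓝 (s * inner ℝ (p - u) (x - p) + 0 * (s / 2 * ‖x - p‖ ^ 2))) := by
      apply Tendsto.mono_left _ nhdsWithin_le_nhds
      exact Continuous.tendsto (by fun_prop) 0
    have h5 := ge_of_tendsto hlim (b := r - a) (by
      filter_upwards [Ioc_mem_nhdsGT (zero_lt_one' ℝ)] with t ht
      exact key t ht.1 ht.2)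
    rw [inner_smul_left, ← neg_sub p u, inner_neg_left]
    simp only [conj_trivial]
    linarith

/-- The minimizer of the regularized conjugate is a subgradient at the proximal point. -/
theorem IsClosedProperConvex.isSubgrad_of_isMinOn [ProperSpace X] (hf : IsClosedProperConvex f)
    {s : ℝ} (hs : 0 < s) (u z : X)
    (hz : IsMinOn (fun z => ((s / 2 * ‖u - s⁻¹ • z‖ ^ 2 : ℝ) : EReal) + conj f z) Set.univ z) :
    IsSubgrad f (u - s⁻¹ • z) z := by
  obtain ⟨p, r, hr, hp⟩ := hf.exists_subgrad_prox hs u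
  -- The subgradient at the primal proximal point is the competitor. Fenchel–Young at `p` shows that
  -- the minimality of `z` leaves room only for `‖v - p‖ = 0`.
  have h1 := hz (Set.mem_univ (s • (u - p)))
  simp only [Set.mem_ofPred_eq, conj_eq_of_subgrad hr hp] at h1
  have h2 := (add_le_add_right (le_conj (z := z) hr)
    ((s / 2 * ‖u - s⁻¹ • z‖ ^ 2 : ℝ) : EReal)).trans h1
  rw [← EReal.coe_add, ← EReal.coe_add, EReal.coe_le_coe_iff, inv_smul_smul₀ hs.ne',
    sub_sub_cancel] at h2
  set v := u - s⁻¹ • z with hv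
  have e : z = s • (u - v) := by
    rw [hv, sub_sub_cancel, smul_inv_smul₀ hs.ne']
  clear_value v
  have h3 : s / 2 * ‖v - p‖ ^ 2 ≤ 0 := by
    rw [e, inner_smul_right, inner_smul_right, inner_sub_right,
      inner_sub_right, real_inner_self_eq_norm_sq] at h2
    rw [norm_sub_sq_real, real_inner_comm]
    nlinarith
  have h4 : v = p := by
    have : ‖v - p‖ ^ 2 ≤ 0 := by
      by_contra! h
      have := mul_pos (half_pos hs) h
      linarith
    have h5 : ‖v - p‖ = 0 := by
      apply pow_eq_zero_iff (two_ne_zero) |>.1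
      exact le_antisymm this (sq_nonneg _)
    exact sub_eq_zero.1 (norm_eq_zero.1 h5)
  rw [h4, e, h4]
  exact ⟨r, hr, hp⟩

/-- The subgradient relation is closed. -/
theorem IsClosedProperConvex.isSubgrad_of_tendsto (hf : IsClosedProperConvex f)
    {ι : Type*} {l : Filter ι} [l.NeBot] {p z : ι → X} {p₀ z₀ : X}
    (h : ∀ᶠ k in l, IsSubgrad f (p k) (z k)) (hp : Tendsto p l (𝓝 p₀)) (hz : Tendsto z l (𝓝 z₀)) :
    IsSubgrad f p₀ z₀ := by
  -- Lower semicontinuity is used only through reals `c` below `f p₀`, so the inequality is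
  -- available before `f p₀` is known to be finite; it then excludes `f p₀ = ⊤`.
  have key : ∀ x (a c : ℝ), f x = a → (c : EReal) < f p₀ → c + inner ℝ z₀ (x - p₀) ≤ a := by
    intro x a c hx hc
    have hl : Tendsto (fun k => c + inner ℝ (z k) (x - p k)) l (𝓝 (c + inner ℝ z₀ (x - p₀))) :=
      (hz.inner (hp.const_sub x)).const_add c
    refine le_of_tendsto hl ?_
    filter_upwards [h, hp.eventually (hf.closed p₀ c hc)] with k hk hck
    obtain ⟨r, hr, hk⟩ := hk
    rw [hr, gt_iff_lt, EReal.coe_lt_coe_iff] at hck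
    have := hk x
    rw [hx, EReal.coe_le_coe_iff] at this
    linarith
  obtain ⟨x₀, a₀, hx₀⟩ := hf.exists_real
  obtain ⟨r, hr⟩ : ∃ r : ℝ, f p₀ = r := by
    induction hfp : f p₀ using EReal.rec with
    | bot => exact absurd hfp (hf.ne_bot p₀)
    | top =>
      have := key x₀ a₀ (a₀ - inner ℝ z₀ (x₀ - p₀) + 1) hx₀ (by rw [hfp]; exact EReal.coe_lt_top _)
      linarith
    | coe a => exact ⟨a, rfl⟩
  refine ⟨r, hr, fun x => ?_⟩
  induction hfx : f x using EReal.rec with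
  | bot => exact absurd hfx (hf.ne_bot x)
  | top => exact le_top
  | coe a =>
    rw [EReal.coe_le_coe_iff]
    refine le_of_forall_lt fun c hc => ?_
    have h1 := key x a ((c + (r + inner ℝ z₀ (x - p₀))) / 2 - inner ℝ z₀ (x - p₀)) hfx (by
      rw [hr, EReal.coe_lt_coe_iff]; linarith)
    linarith

end ConvexAnalysis

/-! ### The spaces `H_β^⊥`, weak and strong duality, and primal optimality -/

section Duality

set_option linter.unusedSectionVars false

variable {V : Type*} [Fintype V] [DecidableEq V] {E : Finset (V × V)} {m : ℕ}

/-- The vector of the product space with the component `v` at `a` and zeros elsewhere. -/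
def single (E : Finset (V × V)) (a : Idx E) (v : Vec m) : ProdSpace E m :=
  WithLp.toLp 2 (Pi.single a v)

theorem single_apply (a b : Idx E) (v : Vec m) :
    single E a v b = if b = a then v else 0 := by
  simp only [single, Pi.single_apply]

theorem inner_single (x : ProdSpace E m) (a : Idx E) (v : Vec m) :
    inner ℝ x (single E a v) = inner ℝ (x a) v := by
  rw [PiLp.inner_apply, Finset.sum_eq_single a]
  · simp [single_apply]
  · intro b _ hb
    simp [single_apply, hb]
  · simp

theorem inner_const (x : Vec m) (w : ProdSpace E m) :
    inner ℝ (WithLp.toLp 2 fun _ => x : ProdSpace E m) w = inner ℝ x (∑ a, w a) := by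
  rw [PiLp.inner_apply, inner_sum]

theorem single_sub_single_mem (a c : Idx E) (v : Vec m) :
    single E a v - single E c v ∈ (hyper m s(a, c))ᗮ := by
  rw [Submodule.mem_orthogonal]
  intro x hx
  rw [inner_sub_right, inner_single, inner_single,
    hx a (Sym2.mem_mk_left a c) c (Sym2.mem_mk_right a c), sub_self]

/-- Constant vectors lie in every `H_β`; test orthogonality against the constant vector whose value
is the sum itself. -/
theorem sum_eq_zero_of_mem_orthogonal {b : Sym2 (Idx E)} {w : ProdSpace E m}
    (hw : w ∈ (hyper m b)ᗮ) : ∑ a, w a = 0 := by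
  rw [Submodule.mem_orthogonal] at hw
  have h := hw (WithLp.toLp 2 fun _ => ∑ a, w a) (fun a _ c _ => rfl)
  rw [inner_const] at h
  exact inner_self_eq_zero.1 h

/-- `w` is a sum of elements of the spaces `H_β^⊥` for the pairs `β` in `T`. -/
def IsPairSum (T : Set (pairs E)) (w : ProdSpace E m) : Prop :=
  ∃ zF : pairs E → ProdSpace E m, (∀ b, zF b ∈ (hyper m b.1)ᗮ) ∧ (∀ b, b ∉ T → zF b = 0) ∧
    ∑ b, zF b = w

theorem IsPairSum.zero (T : Set (pairs E)) : IsPairSum T (0 : ProdSpace E m) :=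
  ⟨0, fun _ => Submodule.zero_mem _, fun _ _ => rfl, by simp⟩

theorem IsPairSum.add {T : Set (pairs E)} {w w' : ProdSpace E m} (h : IsPairSum T w)
    (h' : IsPairSum T w') : IsPairSum T (w + w') := by
  obtain ⟨z, h1, h2, h3⟩ := h
  obtain ⟨z', h1', h2', h3'⟩ := h'
  refine ⟨z + z', fun b => Submodule.add_mem _ (h1 b) (h1' b), fun b hb => ?_, ?_⟩
  · simp [h2 b hb, h2' b hb]
  · simp only [Pi.add_apply, Finset.sum_add_distrib, h3, h3']

theorem IsPairSum.sum {ι : Type*} {T : Set (pairs E)} (t : Finset ι) {w : ι → ProdSpace E m}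
    (h : ∀ i ∈ t, IsPairSum T (w i)) : IsPairSum T (∑ i ∈ t, w i) := by
  classical
  induction t using Finset.induction_on with
  | empty => simpa using IsPairSum.zero T
  | insert i t hi ih =>
    rw [Finset.sum_insert hi]
    exact (h i (Finset.mem_insert_self i t)).add
      (ih fun j hj => h j (Finset.mem_insert_of_mem hj))

theorem IsPairSum.mono {T T' : Set (pairs E)} (hT : T ⊆ T') {w : ProdSpace E m}
    (h : IsPairSum T w) : IsPairSum T' w := by
  obtain ⟨z, h1, h2, h3⟩ := h
  exact ⟨z, h1, fun b hb => h2 b fun h => hb (hT h), h3⟩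

theorem isPairSum_single {T : Set (pairs E)} {b : pairs E} (hb : b ∈ T) {w : ProdSpace E m}
    (hw : w ∈ (hyper m b.1)ᗮ) : IsPairSum T w := by
  classical
  refine ⟨Pi.single b w, fun c => ?_, fun c hc => ?_, Fintype.sum_pi_single' b w⟩
  · by_cases h : c = b
    · subst h; simpa using hw
    · simp [h]
  · have h : c ≠ b := fun h => hc (h ▸ hb)
    simp [h]

/-- The pairs that do not contain the extra index. -/
def innerPairs (E : Finset (V × V)) : Set (pairs E) := {b | none ∉ b.1}

theorem isPairSum_source (e : E) (v : Vec m) :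
    IsPairSum (innerPairs E) (single E (node e.1.1) v - single E (edge e) v) := by
  refine isPairSum_single (b := ⟨s(node e.1.1, edge e), ?_⟩) ?_ (single_sub_single_mem _ _ v)
  · simp [pairs]
  · simp [innerPairs]

theorem isPairSum_target (e : E) (v : Vec m) :
    IsPairSum (innerPairs E) (single E (node e.1.2) v - single E (edge e) v) := by
  refine isPairSum_single (b := ⟨s(node e.1.2, edge e), ?_⟩) ?_ (single_sub_single_mem _ _ v)
  · simp [pairs]
  · simp [innerPairs]

theorem single_neg (a : Idx E) (v : Vec m) : single E a (-v) = -single E a v := by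
  ext b : 1
  simp only [single_apply, PiLp.neg_apply]
  split_ifs <;> simp

/-- Telescope along a directed path, passing from each node to the next through the index of the
edge between them. -/
theorem isPairSum_node_node (hE : StronglyConnected E) (i j : V) (v : Vec m) :
    IsPairSum (innerPairs E) (single E (node i) v - single E (node j) v) := by
  induction hE i j with
  | refl => simpa using IsPairSum.zero _
  | @tail b c _ hbc ih =>
    have h1 := isPairSum_source (⟨(b, c), hbc⟩ : E) v
    have h2 := isPairSum_target (⟨(b, c), hbc⟩ : E) (-v)
    have h3 := (ih.add h1).add h2
    rw [single_neg, single_neg] at h3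
    convert h3 using 1
    abel

theorem isPairSum_some_node (hE : StronglyConnected E) (a : V ⊕ E) (j : V) (v : Vec m) :
    IsPairSum (innerPairs E) (single E (some a) v - single E (node j) v) := by
  rcases a with i | e
  · exact isPairSum_node_node hE i j v
  · have h1 := (isPairSum_source e (-v)).add (isPairSum_node_node hE e.1.1 j v)
    rw [single_neg, single_neg] at h1
    convert h1 using 1
    abel

/-- Move every component to the base index `a₀`; what accumulates there is the total sum, which is
zero. -/
theorem isPairSum_of_sum_eq_zero {T : Set (pairs E)} (a₀ : Idx E) {w : ProdSpace E m}
    (h : ∀ a, IsPairSum T (single E a (w a) - single E a₀ (w a))) (hw : ∑ a, w a = 0) :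
    IsPairSum T w := by
  convert IsPairSum.sum Finset.univ fun a _ => h a using 1
  ext b : 1
  rw [Finset.sum_sub_distrib, PiLp.sub_apply, WithLp.ofLp_sum, WithLp.ofLp_sum, Finset.sum_apply,
    Finset.sum_apply]
  simp only [single_apply]
  by_cases hb : b = a₀ <;> simp [hb, hw]

/-- A vector with sum zero that vanishes at the extra index is a sum of elements of `H_β^⊥` for
pairs `β` without the extra index. -/
theorem isPairSum_inner [Nonempty V] (hE : StronglyConnected E) {w : ProdSpace E m}
    (hw : ∑ a, w a = 0) (h0 : w none = 0) : IsPairSum (innerPairs E) w := by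
  obtain ⟨j⟩ := ‹Nonempty V›
  refine isPairSum_of_sum_eq_zero (node j) (fun a => ?_) hw
  rcases a with _ | a
  · have : ∀ b : Idx E, single E b (0 : Vec m) = 0 := fun b => by
      ext c : 1
      simp [single_apply]
    simpa [h0, this] using IsPairSum.zero _
  · exact isPairSum_some_node hE a j _

/-- Needed for strong duality, where `s none` may be positive: a component at the extra index is
carried to a node by a pair containing that index. -/
theorem isPairSum_univ [Nonempty V] (hE : StronglyConnected E) {w : ProdSpace E m}
    (hw : ∑ a, w a = 0) : IsPairSum Set.univ w := by
  obtain ⟨j⟩ := ‹Nonempty V›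
  refine isPairSum_of_sum_eq_zero (node j) (fun a => ?_) hw
  rcases a with _ | a
  · refine isPairSum_single (b := ⟨s(none, node j), ?_⟩) (Set.mem_univ _)
      (single_sub_single_mem _ _ _)
    simp [pairs]
  · exact (isPairSum_some_node hE a j _).mono (Set.subset_univ _)

theorem conj_lift_single (f : V → Vec m → EReal) (i : V) (v : Vec m) :
    conj (lift (E := E) f i) (single E (node i) v) = conj (f i) v := by
  apply le_antisymm
  · refine iSup_le fun x => ?_
    rw [inner_single]
    exact le_iSup (fun x : Vec m => ((inner ℝ x v : ℝ) : EReal) - f i x) (x (node i))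
  · refine iSup_le fun x => ?_
    refine le_trans (le_of_eq ?_) (le_iSup _ (single E (node i) x))
    rw [inner_single]
    simp [lift, single_apply]

theorem indic_nonneg {X : Type*} (A : Set X) (x : X) : 0 ≤ indic A x := by
  unfold indic
  split_ifs <;> simp

theorem indic_of_mem {X : Type*} {A : Set X} {x : X} (h : x ∈ A) : indic A x = 0 := by
  simp [indic, h]

/-- The common optimal value of the dual problems, in terms of the primal solution `x` and of the
values `r i = f_i(x)`. -/
noncomputable def optValue (mbar x : Vec m) (r : V → ℝ) : ℝ :=
  (Fintype.card V : ℝ) * inner ℝ mbar x - ∑ i, r i - (Fintype.card V : ℝ) / 2 * ‖x‖ ^ 2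

/-- Fenchel–Young for the quadratic term: for `s > 0` the difference of the sides is `s / 2 * ‖v -
x‖ ^ 2` with `v = mbar - s⁻¹ • w`. -/
theorem le_quad {s : ℝ} (hs : 0 ≤ s) (mbar w x : Vec m) :
    ((s * inner ℝ mbar x - inner ℝ w x - s / 2 * ‖x‖ ^ 2 : ℝ) : EReal) ≤ quad s mbar w := by
  unfold quad
  split_ifs with h
  · by_cases hw : w = 0
    · simp [indic, h, hw]
    · simp [indic, hw]
  · have hs' : 0 < s := lt_of_le_of_ne hs (Ne.symm h)
    rw [EReal.coe_le_coe_iff]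
    set v := mbar - s⁻¹ • w with hv
    have e : w = s • (mbar - v) := by rw [hv, sub_sub_cancel, smul_inv_smul₀ hs'.ne']
    clear_value v
    rw [e, inner_smul_left, inner_sub_left]
    simp only [conj_trivial]
    have h1 : 0 ≤ s / 2 * ‖v - x‖ ^ 2 := by positivity
    rw [norm_sub_sq_real] at h1
    nlinarith

theorem coe_sum_real {ι : Type*} (t : Finset ι) (g : ι → ℝ) :
    ((∑ i ∈ t, g i : ℝ) : EReal) = ∑ i ∈ t, (g i : EReal) := by
  classical
  induction t using Finset.induction_on with
  | empty => simp
  | insert i t hi ih => rw [Finset.sum_insert hi, Finset.sum_insert hi, EReal.coe_add, ih]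

theorem sum_pairs_apply {zF : pairs E → ProdSpace E m} (h : ∀ b, zF b ∈ (hyper m b.1)ᗮ) :
    ∑ a, (∑ b, zF b) a = 0 := by
  simp only [WithLp.ofLp_sum, Finset.sum_apply]
  rw [Finset.sum_comm]
  exact Finset.sum_eq_zero fun b _ => sum_eq_zero_of_mem_orthogonal (h b)

/-- Weak duality. -/
theorem optValue_le_dualObj (f : V → Vec m → EReal) (mbar : Vec m) {s : Idx E → ℝ}
    (hs : IsWeight s) {x : Vec m} {r : V → ℝ} (hr : ∀ i, f i x = r i)
    (z : V ⊕ pairs E → ProdSpace E m) :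
    ((optValue mbar x r : ℝ) : EReal) ≤ dualObj f mbar s z := by
  have hconj : ((∑ i, (inner ℝ x (∑ a, z (Sum.inl i) a) - r i) : ℝ) : EReal) ≤
      ∑ i, conj (lift (E := E) f i) (z (Sum.inl i)) := by
    rw [coe_sum_real]
    refine Finset.sum_le_sum fun i _ => ?_
    have := le_conj (f := lift (E := E) f i) (x := WithLp.toLp 2 fun _ => x) (z := z (Sum.inl i))
      (hr i)
    rwa [inner_const] at this
  have hq : ((∑ a, (s a * inner ℝ mbar x - inner ℝ ((∑ c, z c) a) x - s a / 2 * ‖x‖ ^ 2) : ℝ) :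
      EReal) ≤ ∑ a, quad (s a) mbar ((∑ c, z c) a) := by
    rw [coe_sum_real]
    exact Finset.sum_le_sum fun a _ => le_quad (hs.nonneg a) _ _ _
  have hqbot : ∑ a, quad (s a) mbar ((∑ c, z c) a) ≠ ⊥ :=
    ne_bot_of_le_ne_bot (EReal.coe_ne_bot _) hq
  have hcbot : ∑ i, conj (lift (E := E) f i) (z (Sum.inl i)) ≠ ⊥ :=
    ne_bot_of_le_ne_bot (EReal.coe_ne_bot _) hconj
  unfold dualObj
  by_cases hmem : ∀ b : pairs E, z (Sum.inr b) ∈ (hyper m b.1)ᗮ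
  · have h0 : ∑ b : pairs E, indic ((hyper m b.1)ᗮ : Set (ProdSpace E m)) (z (Sum.inr b)) = 0 :=
      Finset.sum_eq_zero fun b _ => indic_of_mem (hmem b)
    rw [h0, add_zero]
    refine le_trans ?_ (add_le_add hconj hq)
    rw [← EReal.coe_add, EReal.coe_le_coe_iff]
    apply le_of_eq
    -- Pairing with the constant vector `x` makes the pair variables disappear; the weights then
    -- enter only through `∑ s = |V|`.
    have hsum : ∑ a, (∑ c, z c) a = ∑ i, ∑ a, z (Sum.inl i) a := by
      rw [Fintype.sum_sum_type]
      simp only [PiLp.add_apply, Finset.sum_add_distrib]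
      rw [sum_pairs_apply hmem, add_zero]
      simp only [WithLp.ofLp_sum, Finset.sum_apply]
      rw [Finset.sum_comm]
    rw [Finset.sum_sub_distrib, Finset.sum_sub_distrib, Finset.sum_sub_distrib, ← Finset.sum_mul,
      ← Finset.sum_mul, ← Finset.sum_div, hs.sum_eq, ← sum_inner, hsum, ← inner_sum,
      real_inner_comm _ x]
    unfold optValue
    ring
  · push Not at hmem
    obtain ⟨b, hb⟩ := hmem
    have htop : ∑ b : pairs E, indic ((hyper m b.1)ᗮ : Set (ProdSpace E m)) (z (Sum.inr b)) = ⊤ := by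
      rw [eq_top_iff]
      refine le_trans (le_of_eq ?_) (Finset.single_le_sum (fun c _ => indic_nonneg _ _)
        (Finset.mem_univ b))
      exact (if_neg hb).symm
    rw [htop, EReal.add_top_of_ne_bot hcbot, EReal.top_add_of_ne_bot hqbot]
    exact le_top

/-- Strong duality, for a primal solution `x` with subgradients `z i` of the `f i`. -/
theorem dualValue_eq [Nonempty V] (hE : StronglyConnected E) (f : V → Vec m → EReal)
    (mbar : Vec m) {s : Idx E → ℝ} (hs : IsWeight s) {x : Vec m} {r : V → ℝ} {z : V → Vec m}
    (hr : ∀ i, f i x = r i)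
    (hz : ∀ i y, ((r i + inner ℝ (z i) (y - x) : ℝ) : EReal) ≤ f i y)
    (hx : ∑ i, z i = (Fintype.card V : ℝ) • (mbar - x)) :
    dualValue f mbar s = ((optValue mbar x r : ℝ) : EReal) := by
  refine le_antisymm ?_ (le_iInf fun z => optValue_le_dualObj f mbar hs hr z)
  -- What the pair variables must supply for each weighted term to see the same point `x`, that is,
  -- for the total to have components `s a • (mbar - x)`.
  have hw : ∑ a, (WithLp.toLp 2 (fun a => s a • (mbar - x)) -
      ∑ i, single E (node i) (z i) : ProdSpace E m) a = 0 := by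
    simp only [PiLp.sub_apply, Finset.sum_sub_distrib, WithLp.ofLp_sum, Finset.sum_apply]
    rw [Finset.sum_comm (f := fun a i => single E (node i) (z i) a), ← Finset.sum_smul, hs.sum_eq]
    simp [single_apply, hx]
  obtain ⟨zF, h1, -, h3⟩ := isPairSum_univ hE hw
  refine iInf_le_of_le (Sum.elim (fun i => single E (node i) (z i)) zF) (le_of_eq ?_)
  unfold dualObj
  have hsum : ∑ c, (Sum.elim (fun i => single E (node i) (z i)) zF : V ⊕ pairs E → ProdSpace E m) c
      = WithLp.toLp 2 (fun a => s a • (mbar - x)) := by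
    rw [Fintype.sum_sum_type]
    simp only [Sum.elim_inl, Sum.elim_inr, h3]
    abel
  have hq : ∀ a, quad (s a) mbar (s a • (mbar - x)) = ((s a / 2 * ‖x‖ ^ 2 : ℝ) : EReal) := by
    intro a
    unfold quad
    split_ifs with h
    · simp [h, indic]
    · rw [inv_smul_smul₀ h, sub_sub_cancel]
  rw [hsum]
  simp only [Sum.elim_inl, Sum.elim_inr, conj_lift_single, hq]
  rw [Finset.sum_eq_zero (s := Finset.univ (α := pairs E)) fun b _ => indic_of_mem (h1 b), add_zero,
    ← coe_sum_real, Finset.sum_congr rfl fun i _ => conj_eq_of_subgrad (hr i) (hz i),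
    ← coe_sum_real, ← EReal.coe_add, EReal.coe_eq_coe_iff, Finset.sum_sub_distrib, ← inner_sum, hx,
    ← Finset.sum_mul, ← Finset.sum_div, hs.sum_eq, inner_smul_right, inner_sub_right,
    real_inner_self_eq_norm_sq, real_inner_comm]
  unfold optValue
  ring

/-- The primal objective grows quadratically from a point with subgradients that add up. -/
theorem primalObj_ge (f : V → Vec m → EReal) (xbar : V → Vec m) {x : Vec m} {r : V → ℝ}
    {z : V → Vec m} (hz : ∀ i y, ((r i + inner ℝ (z i) (y - x) : ℝ) : EReal) ≤ f i y)
    (hx : ∑ i, z i = ∑ i, (xbar i - x)) (y : Vec m) :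
    ((∑ i, (r i + 1 / 2 * ‖x - xbar i‖ ^ 2) + (Fintype.card V : ℝ) / 2 * ‖y - x‖ ^ 2 : ℝ) : EReal)
      ≤ primalObj f xbar y := by
  have h1 : ((∑ i, (r i + inner ℝ (z i) (y - x) + 1 / 2 * ‖y - xbar i‖ ^ 2) : ℝ) : EReal) ≤
      primalObj f xbar y := by
    rw [coe_sum_real]
    refine Finset.sum_le_sum fun i _ => ?_
    rw [EReal.coe_add]
    exact add_le_add_left (hz i y) _
  refine le_trans (le_of_eq ?_) h1
  congr 1
  have h2 : ∀ i, 1 / 2 * ‖y - xbar i‖ ^ 2 =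
      1 / 2 * ‖x - xbar i‖ ^ 2 - inner ℝ (xbar i - x) (y - x) + 1 / 2 * ‖y - x‖ ^ 2 := by
    intro i
    have e : y - xbar i = (y - x) - (xbar i - x) := by abel
    rw [e, norm_sub_sq_real, ← norm_neg (x - xbar i), neg_sub, real_inner_comm]
    ring
  simp only [h2, Finset.sum_add_distrib, Finset.sum_sub_distrib, ← sum_inner, hx]
  simp
  ring

theorem isMinOn_primalObj_iff [Nonempty V] (f : V → Vec m → EReal) (xbar : V → Vec m) {x : Vec m}
    {r : V → ℝ} {z : V → Vec m} (hr : ∀ i, f i x = r i)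
    (hz : ∀ i y, ((r i + inner ℝ (z i) (y - x) : ℝ) : EReal) ≤ f i y)
    (hx : ∑ i, z i = ∑ i, (xbar i - x)) :
    primalObj f xbar x ≠ ⊤ ∧ ∀ y, IsMinOn (primalObj f xbar) Set.univ y ↔ y = x := by
  have hval : primalObj f xbar x = ((∑ i, (r i + 1 / 2 * ‖x - xbar i‖ ^ 2) : ℝ) : EReal) := by
    simp only [primalObj, hr, coe_sum_real, EReal.coe_add]
  have hN : 0 < (Fintype.card V : ℝ) := by exact_mod_cast Fintype.card_pos
  refine ⟨by rw [hval]; exact EReal.coe_ne_top _, fun y => ⟨fun h => ?_, ?_⟩⟩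
  · have h1 := (primalObj_ge f xbar hz hx y).trans (isMinOn_iff.1 h x (Set.mem_univ x))
    rw [hval, EReal.coe_le_coe_iff] at h1
    have h2 : (Fintype.card V : ℝ) / 2 * ‖y - x‖ ^ 2 ≤ 0 := by linarith
    by_contra hne
    have : 0 < ‖y - x‖ := norm_pos_iff.2 (sub_ne_zero.2 hne)
    have : 0 < (Fintype.card V : ℝ) / 2 * ‖y - x‖ ^ 2 := by positivity
    linarith
  · rintro rfl
    rw [isMinOn_iff]
    intro y' _
    refine le_trans ?_ (primalObj_ge f xbar hz hx y')
    rw [hval, EReal.coe_le_coe_iff]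
    have : 0 ≤ (Fintype.card V : ℝ) / 2 * ‖y' - y‖ ^ 2 := by positivity
    linarith

end Duality

/-! ### Conserved quantities and the decrease of the potential under each operation -/

section Steps

set_option linter.unusedSectionVars false

variable {V : Type*} [Fintype V] [DecidableEq V] {E : Finset (V × V)} {m : ℕ}

/-- The quadratic term `‖y‖² / (2s)`. -/
noncomputable def phi (y : Vec m) (s : ℝ) : ℝ := ‖y‖ ^ 2 / (2 * s)

theorem phi_nonneg (y : Vec m) {s : ℝ} (hs : 0 ≤ s) : 0 ≤ phi y s := by
  unfold phi; positivity

/-- Second-order expansion about `s • x`. With a common `x` the first two terms are additive in `(s,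
y)`, so only the quadratic remainders matter when vectors are merged. -/
theorem phi_expand {y : Vec m} {s : ℝ} (h : (s = 0 ∧ y = 0) ∨ 0 < s) (x : Vec m) :
    phi y s = s / 2 * ‖x‖ ^ 2 + inner ℝ x (y - s • x) + ‖y - s • x‖ ^ 2 / (2 * s) := by
  rcases h with ⟨rfl, rfl⟩ | hs
  · simp [phi]
  · obtain ⟨w, rfl⟩ : ∃ w, y = s • x + w := ⟨y - s • x, by abel⟩
    rw [add_sub_cancel_left]
    unfold phi
    rw [norm_add_sq_real, norm_smul, Real.norm_of_nonneg hs.le, inner_smul_left]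
    simp only [conj_trivial]
    field_simp

/-- Merging two weighted vectors decreases the sum of the quadratic terms. -/
theorem phi_merge {y₁ y₂ : Vec m} {s₁ s₂ ε N : ℝ} (hε : 0 < ε) (h₁ : ε ≤ s₁)
    (h₂ : (s₂ = 0 ∧ y₂ = 0) ∨ 0 < s₂) (hN : s₁ + s₂ ≤ N) :
    phi (y₁ + y₂) (s₁ + s₂) + ε / (2 * N ^ 2) * ‖y₂ - s₂ • s₁⁻¹ • y₁‖ ^ 2 ≤
      phi y₁ s₁ + phi y₂ s₂ := by
  have hs₁ : 0 < s₁ := hε.trans_le h₁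
  -- Expanding about the point of the first vector kills its remainder. The gain is then the
  -- remainder of `y₂` over `2 * s₂` minus the same over `2 * (s₁ + s₂)`.
  set x := s₁⁻¹ • y₁ with hx
  have hy₁ : y₁ - s₁ • x = 0 := by rw [hx, smul_inv_smul₀ hs₁.ne', sub_self]
  rcases h₂ with ⟨rfl, rfl⟩ | hs₂
  · simp [phi]
  · rw [phi_expand (Or.inr hs₁) x, phi_expand (Or.inr hs₂) x,
      phi_expand (Or.inr (add_pos hs₁ hs₂)) x]
    have e : y₁ + y₂ - (s₁ + s₂) • x = y₂ - s₂ • x := by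
      have : y₁ + y₂ - (s₁ + s₂) • x = (y₁ - s₁ • x) + (y₂ - s₂ • x) := by
        rw [add_smul]; abel
      rw [this, hy₁, zero_add]
    rw [e, hy₁]
    set w := ‖y₂ - s₂ • x‖ ^ 2 with hw
    have hw0 : 0 ≤ w := by positivity
    have hN0 : 0 < N := by linarith
    have h3 : w / (2 * s₂) - w / (2 * (s₁ + s₂)) = s₁ / (2 * (s₂ * (s₁ + s₂))) * w := by
      field_simp
      ring
    have h4 : ε / (2 * N ^ 2) ≤ s₁ / (2 * (s₂ * (s₁ + s₂))) := by
      have : s₂ * (s₁ + s₂) ≤ N ^ 2 := by nlinarith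
      gcongr
    have h5 := mul_le_mul_of_nonneg_right h4 hw0
    simp only [inner_zero_right, norm_zero]
    ring_nf at *
    linarith

theorem sum_eq_add_sub {ι M : Type*} [Fintype ι] [DecidableEq ι] [AddCommGroup M] {g g' : ι → M}
    (i : ι) (h : ∀ j, j ≠ i → g' j = g j) : ∑ j, g' j = ∑ j, g j + (g' i - g i) := by
  rw [← Finset.add_sum_erase _ _ (Finset.mem_univ i),
    ← Finset.add_sum_erase (a := i) Finset.univ g (Finset.mem_univ i),
    Finset.sum_congr rfl fun j hj => h j (Finset.ne_of_mem_erase hj)]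
  abel

/-- `s_e` for an edge `e`. -/
def State.edgeS (S : State E m) (e : E) : ℝ := S.sigS e.1.1 - S.rhoS e

/-- `y_e` for an edge `e`. -/
def State.edgeY (S : State E m) (e : E) : Vec m := S.sigY e.1.1 - S.rhoY e

/-- `x_i` for a node `i`. -/
noncomputable def State.nodeX (S : State E m) (i : V) : Vec m := (S.s i)⁻¹ • S.y i

/-- The quadratic part of `Val`. -/
noncomputable def State.quadPart (S : State E m) : ℝ :=
  ∑ i, phi (S.y i) (S.s i) + ∑ e, phi (S.edgeY e) (S.edgeS e)

/-- The properties of the weights and of the vectors that all operations preserve. -/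
structure State.Inv (mbar : Vec m) (ε : ℝ) (S : State E m) : Prop where
  node : ∀ i, ε < S.s i
  edge : ∀ e, (S.edgeS e = 0 ∧ S.edgeY e = 0) ∨ ε ≤ S.edgeS e
  sum_s : ∑ i, S.s i + ∑ e, S.edgeS e = Fintype.card V
  sum_y : ∑ i, S.y i + ∑ e, S.edgeY e + ∑ i, S.z i = (Fintype.card V : ℝ) • mbar

theorem State.IsInitial.inv {mbar : Vec m} {ε : ℝ} {S : State E m} (h : S.IsInitial mbar)
    (hs : ∀ i, ε < S.s i) : S.Inv mbar ε where
  node := hs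
  edge e := Or.inl ⟨by simp [State.edgeS, h.sigS_eq, h.rhoS_eq],
    by simp [State.edgeY, h.sigY_eq, h.rhoY_eq]⟩
  sum_s := by simp [State.edgeS, h.sigS_eq, h.rhoS_eq, h.s_eq]
  sum_y := by simp [State.edgeY, h.sigY_eq, h.rhoY_eq, h.z_eq, h.y_sum]

theorem sum_out_edges {M : Type*} [AddCommGroup M] [Module ℝ M] (i : V) (c : M) :
    ∑ e : E, (if e.1.1 = i then c else 0) = (outdeg E i : ℝ) • c := by
  rw [Finset.sum_coe_sort E (fun e => if e.1 = i then c else 0), ← Finset.sum_filter,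
    Finset.sum_const, outdeg, Nat.cast_smul_eq_nsmul]

section Send

variable (S : State E m) (i : V)

theorem send_s : (S.send i).s i = S.s i / ((outdeg E i : ℝ) + 1) := by simp [State.send]

theorem send_y : (S.send i).y i = ((outdeg E i : ℝ) + 1)⁻¹ • S.y i := by simp [State.send]

theorem send_s_of_ne {j : V} (h : j ≠ i) : (S.send i).s j = S.s j := by simp [State.send, h]

theorem send_y_of_ne {j : V} (h : j ≠ i) : (S.send i).y j = S.y j := by simp [State.send, h]

theorem send_edgeS (e : E) :
    (S.send i).edgeS e = S.edgeS e + if e.1.1 = i then (S.send i).s i else 0 := by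
  simp only [State.edgeS, State.send, Function.update_self, Function.update_apply]
  split_ifs with h
  · rw [h]; ring
  · ring

theorem send_edgeY (e : E) :
    (S.send i).edgeY e = S.edgeY e + if e.1.1 = i then (S.send i).y i else 0 := by
  simp only [State.edgeY, State.send, Function.update_self, Function.update_apply]
  split_ifs with h
  · rw [h]; abel
  · abel

theorem send_s_mul : S.s i = ((outdeg E i : ℝ) + 1) * (S.send i).s i := by
  rw [send_s]; field_simp

theorem send_y_mul : S.y i = ((outdeg E i : ℝ) + 1) • (S.send i).y i := by
  rw [send_y, smul_inv_smul₀ (by positivity)]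

/-- Sending scales `y i` and `s i` by the same factor. -/
theorem send_nodeX (j : V) : (S.send i).nodeX j = S.nodeX j := by
  unfold State.nodeX
  by_cases h : j = i
  · subst h
    rw [send_s_mul S j, send_y_mul S j, smul_smul, mul_inv, mul_assoc, mul_comm, mul_assoc,
      mul_inv_cancel₀ (by positivity), mul_one]
  · rw [send_s_of_ne S i h, send_y_of_ne S i h]

end Send

namespace State.Inv

variable {mbar : Vec m} {ε : ℝ} {S : State E m}

theorem edge_cases (h : S.Inv mbar ε) (hε : 0 < ε) (e : E) :
    (S.edgeS e = 0 ∧ S.edgeY e = 0) ∨ 0 < S.edgeS e :=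
  (h.edge e).imp id fun h' => hε.trans_le h'

theorem edge_nonneg (h : S.Inv mbar ε) (hε : 0 < ε) (e : E) : 0 ≤ S.edgeS e := by
  rcases h.edge_cases hε e with h | h
  · exact h.1.ge
  · exact h.le

theorem node_add_edge_le (h : S.Inv mbar ε) (hε : 0 < ε) (i : V) (e : E) :
    S.s i + S.edgeS e ≤ Fintype.card V := by
  rw [← h.sum_s]
  exact add_le_add (Finset.single_le_sum (fun j _ => (hε.trans (h.node j)).le) (Finset.mem_univ i))
    (Finset.single_le_sum (fun e _ => h.edge_nonneg hε e) (Finset.mem_univ e))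

theorem node_le (h : S.Inv mbar ε) (hε : 0 < ε) (i : V) : S.s i ≤ Fintype.card V := by
  rw [← h.sum_s]
  have h1 := Finset.single_le_sum (f := S.s) (fun j _ => (hε.trans (h.node j)).le)
    (Finset.mem_univ i)
  have h2 : 0 ≤ ∑ e, S.edgeS e := Finset.sum_nonneg fun e _ => h.edge_nonneg hε e
  linarith

theorem edge_le (h : S.Inv mbar ε) (hε : 0 < ε) (e : E) : S.edgeS e ≤ Fintype.card V := by
  have := h.node_add_edge_le hε e.1.1 e
  have := h.node e.1.1
  linarith

theorem quadPart_nonneg (h : S.Inv mbar ε) (hε : 0 < ε) : 0 ≤ S.quadPart :=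
  add_nonneg (Finset.sum_nonneg fun i _ => phi_nonneg _ (hε.trans (h.node i)).le)
    (Finset.sum_nonneg fun e _ => phi_nonneg _ (h.edge_nonneg hε e))

theorem send (h : S.Inv mbar ε) (hε : 0 < ε) (i : V) (hs : ∀ j, ε < (S.send i).s j) :
    (S.send i).Inv mbar ε where
  node := hs
  edge e := by
    rw [send_edgeS, send_edgeY]
    split_ifs with he
    -- The share put on the edge is the new weight of the sender, which exceeds `ε`; this is why
    -- edge weights are either zero or at least `ε`.
    · right
      have := h.edge_nonneg hε e
      have := hs i
      linarith
    · simpa using h.edge e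
  sum_s := by
    rw [← h.sum_s, sum_eq_add_sub i fun j hj => send_s_of_ne S i hj]
    simp only [send_edgeS, Finset.sum_add_distrib, sum_out_edges]
    rw [send_s_mul S i, smul_eq_mul]
    ring
  sum_y := by
    rw [← h.sum_y, sum_eq_add_sub i fun j hj => send_y_of_ne S i hj]
    simp only [send_edgeY, Finset.sum_add_distrib, sum_out_edges]
    rw [send_y_mul S i, add_smul, one_smul]
    change _ + _ + ∑ j, S.z j = _
    abel

/-- Splitting `(y i, s i)` into `outdeg + 1` equal shares leaves the total of `phi` unchanged, as
`phi` is homogeneous of degree one. Merging one share into each outgoing edge then gains by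
`phi_merge`. -/
theorem quadPart_send (h : S.Inv mbar ε) (hε : 0 < ε) (i : V) (hs : ε < (S.send i).s i) :
    (S.send i).quadPart + ∑ e : E, (if e.1.1 = i then ε / (2 * (Fintype.card V : ℝ) ^ 2) *
      ‖S.edgeY e - S.edgeS e • S.nodeX i‖ ^ 2 else 0) ≤ S.quadPart := by
  have hd : 0 < (outdeg E i : ℝ) + 1 := by positivity
  have h1 : ∑ j, phi ((S.send i).y j) ((S.send i).s j) = ∑ j, phi (S.y j) (S.s j) -
      (outdeg E i : ℝ) * phi ((S.send i).y i) ((S.send i).s i) := by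
    rw [sum_eq_add_sub (g := fun j => phi (S.y j) (S.s j)) i fun j hj => by
      rw [send_s_of_ne S i hj, send_y_of_ne S i hj]]
    have : phi (S.y i) (S.s i) =
        ((outdeg E i : ℝ) + 1) * phi ((S.send i).y i) ((S.send i).s i) := by
      rw [send_s_mul S i, send_y_mul S i]
      unfold phi
      rw [norm_smul, Real.norm_of_nonneg hd.le]
      have := (hε.trans hs).ne'
      field_simp
    rw [this]
    ring
  have h2 : ∑ e, (phi ((S.send i).edgeY e) ((S.send i).edgeS e) +
      (if e.1.1 = i then ε / (2 * (Fintype.card V : ℝ) ^ 2) *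
        ‖S.edgeY e - S.edgeS e • S.nodeX i‖ ^ 2 else 0)) ≤
      ∑ e, (phi (S.edgeY e) (S.edgeS e) +
        if e.1.1 = i then phi ((S.send i).y i) ((S.send i).s i) else 0) := by
    refine Finset.sum_le_sum fun e _ => ?_
    rw [send_edgeS, send_edgeY]
    split_ifs with he
    · have hN : (S.send i).s i + S.edgeS e ≤ Fintype.card V := by
        have h3 := h.node_add_edge_le hε i e
        have h4 : (S.send i).s i ≤ S.s i := by
          rw [send_s_mul S i]
          have := mul_nonneg (Nat.cast_nonneg (α := ℝ) (outdeg E i)) (hε.trans hs).le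
          linarith
        linarith
      have h5 := phi_merge (y₁ := (S.send i).y i) (y₂ := S.edgeY e) hε hs.le (h.edge_cases hε e) hN
      have h6 : ((S.send i).s i)⁻¹ • (S.send i).y i = S.nodeX i := send_nodeX S i i
      rw [h6] at h5
      rw [add_comm (S.edgeY e), add_comm (S.edgeS e)]
      linarith
    · simp
  rw [Finset.sum_add_distrib, Finset.sum_add_distrib, sum_out_edges, smul_eq_mul] at h2
  unfold State.quadPart
  rw [h1]
  linarith

end State.Inv

section Receive

variable (S : State E m) (e : E)

theorem receive_s : (S.receive e).s e.1.2 = S.s e.1.2 + S.edgeS e := by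
  simp [State.receive, State.edgeS]; ring

theorem receive_y : (S.receive e).y e.1.2 = S.y e.1.2 + S.edgeY e := by
  simp only [State.receive, State.edgeY, Function.update_self]; abel

theorem receive_s_of_ne {j : V} (h : j ≠ e.1.2) : (S.receive e).s j = S.s j := by
  simp [State.receive, h]

theorem receive_y_of_ne {j : V} (h : j ≠ e.1.2) : (S.receive e).y j = S.y j := by
  simp [State.receive, h]

theorem receive_edgeS : (S.receive e).edgeS e = 0 := by simp [State.receive, State.edgeS]

theorem receive_edgeY : (S.receive e).edgeY e = 0 := by simp [State.receive, State.edgeY]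

theorem receive_edgeS_of_ne {e' : E} (h : e' ≠ e) : (S.receive e).edgeS e' = S.edgeS e' := by
  simp [State.receive, State.edgeS, h]

theorem receive_edgeY_of_ne {e' : E} (h : e' ≠ e) : (S.receive e).edgeY e' = S.edgeY e' := by
  simp [State.receive, State.edgeY, h]

end Receive

namespace State.Inv

variable {mbar : Vec m} {ε : ℝ} {S : State E m}

theorem receive (h : S.Inv mbar ε) (e : E) (hs : ∀ j, ε < (S.receive e).s j) :
    (S.receive e).Inv mbar ε where
  node := hs
  edge e' := by
    by_cases he : e' = e
    · subst he
      exact Or.inl ⟨receive_edgeS S e', receive_edgeY S e'⟩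
    · rw [receive_edgeS_of_ne S e he, receive_edgeY_of_ne S e he]
      exact h.edge e'
  sum_s := by
    rw [← h.sum_s, sum_eq_add_sub e.1.2 fun j hj => receive_s_of_ne S e hj,
      sum_eq_add_sub e fun j hj => receive_edgeS_of_ne S e hj, receive_s, receive_edgeS]
    ring
  sum_y := by
    rw [← h.sum_y, sum_eq_add_sub e.1.2 fun j hj => receive_y_of_ne S e hj,
      sum_eq_add_sub e fun j hj => receive_edgeY_of_ne S e hj, receive_y, receive_edgeY]
    change _ + _ + ∑ j, S.z j = _
    abel

theorem quadPart_receive (h : S.Inv mbar ε) (hε : 0 < ε) (e : E) :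
    (S.receive e).quadPart + ε / (2 * (Fintype.card V : ℝ) ^ 2) *
      ‖S.edgeY e - S.edgeS e • S.nodeX e.1.2‖ ^ 2 ≤ S.quadPart := by
  unfold State.quadPart
  rw [sum_eq_add_sub (g := fun j => phi (S.y j) (S.s j)) e.1.2 fun j hj => by
      rw [receive_s_of_ne S e hj, receive_y_of_ne S e hj],
    sum_eq_add_sub (g := fun e => phi (S.edgeY e) (S.edgeS e)) e fun j hj => by
      rw [receive_edgeS_of_ne S e hj, receive_edgeY_of_ne S e hj],
    receive_s, receive_y, receive_edgeS, receive_edgeY]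
  have h1 := phi_merge (y₁ := S.y e.1.2) hε (h.node e.1.2).le (h.edge_cases hε e)
    (h.node_add_edge_le hε e.1.2 e)
  have h2 : phi (0 : Vec m) 0 = 0 := by simp [phi]
  rw [h2]
  change _ + _ * ‖S.edgeY e - S.edgeS e • (S.s e.1.2)⁻¹ • S.y e.1.2‖ ^ 2 ≤ _
  linarith

end State.Inv

/-- The state after operation `C` at node `j` with the new dual vector `z`. -/
def State.prox (S : State E m) (j : V) (z : Vec m) : State E m :=
  { S with
    z := Function.update S.z j z
    y := Function.update S.y j (S.y j + S.z j - z) }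

theorem State.prox_eq (S : State E m) (j : V) (hs : S.s j ≠ 0) (z : Vec m) :
    { S with
      z := Function.update S.z j z
      y := Function.update S.y j (S.s j • S.xTemp j - z) } = S.prox j z := by
  rw [State.xTemp, smul_inv_smul₀ hs, State.prox]

namespace State.Inv

variable {mbar : Vec m} {ε : ℝ} {S : State E m}

theorem prox (h : S.Inv mbar ε) (j : V) (z : Vec m) : (S.prox j z).Inv mbar ε where
  node := h.node
  edge := h.edge
  sum_s := h.sum_s
  sum_y := by
    rw [← h.sum_y, sum_eq_add_sub (g := S.y) (g' := (S.prox j z).y) j fun i hi => by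
        simp [State.prox, hi],
      sum_eq_add_sub (g := S.z) (g' := (S.prox j z).z) j fun i hi => by simp [State.prox, hi]]
    change _ + ∑ e, S.edgeY e + _ = _
    simp only [State.prox, Function.update_self]
    abel

theorem _root_.DualAscent.State.quadPart_prox (S : State E m) (j : V) (z : Vec m) :
    (S.prox j z).quadPart =
      S.quadPart + (phi (S.y j + S.z j - z) (S.s j) - phi (S.y j) (S.s j)) := by
  unfold State.quadPart
  rw [sum_eq_add_sub (g := fun i => phi (S.y i) (S.s i)) j fun i hi => by simp [State.prox, hi]]
  change _ + ∑ e, phi (S.edgeY e) (S.edgeS e) = _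
  simp only [State.prox, Function.update_self]
  ring

end State.Inv

/-- The real value of the objective, where the conjugates are finite. -/
noncomputable def State.realVal (f : V → Vec m → EReal) (S : State E m) : ℝ :=
  ∑ i, (conj (f i) (S.z i)).toReal + S.quadPart

/-- The conjugates are finite at the dual vectors of the nodes. -/
def State.IsFinite (f : V → Vec m → EReal) (S : State E m) : Prop :=
  ∀ i, conj (f i) (S.z i) ≠ ⊤

theorem isSubgrad_prox {f : V → Vec m → EReal} {j : V} (hf : IsClosedProperConvex (f j))
    {S : State E m} (hs : 0 < S.s j) {z : Vec m} (hz : IsMinOn (S.proxObj f j) Set.univ z) :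
    IsSubgrad (f j) ((S.prox j z).nodeX j) z := by
  have h := hf.isSubgrad_of_isMinOn hs (S.xTemp j) z hz
  convert h using 1
  simp only [State.nodeX, State.prox, Function.update_self, State.xTemp, smul_sub]

/-- At the new point `p`, Fenchel–Young is an equality for `z` and an inequality for the old dual
vector. The linear terms cancel against those of `phi_expand` at `p`, leaving `‖z - S.z j‖ ^ 2 / (2
* S.s j)`, and `S.s j ≤ |V|`. -/
theorem realVal_prox {mbar : Vec m} {ε : ℝ} {f : V → Vec m → EReal}
    (hf : ∀ i, IsClosedProperConvex (f i)) {S : State E m} (hS : S.Inv mbar ε) (hε : 0 < ε)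
    {j : V} (hfin : conj (f j) (S.z j) ≠ ⊤) {z : Vec m}
    (hz : IsMinOn (S.proxObj f j) Set.univ z) :
    (S.prox j z).realVal f + 1 / (2 * (Fintype.card V : ℝ)) * ‖z - S.z j‖ ^ 2 ≤ S.realVal f := by
  have hs : 0 < S.s j := hε.trans (hS.node j)
  obtain ⟨r, hr, hsub⟩ := isSubgrad_prox (hf j) hs hz
  set p := (S.prox j z).nodeX j with hp
  have hy' : S.y j + S.z j - z = S.s j • p := by
    rw [hp]
    simp only [State.nodeX, State.prox, Function.update_self]
    rw [smul_inv_smul₀ hs.ne']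
  have h1 : inner ℝ p (S.z j) - r ≤ (conj (f j) (S.z j)).toReal := by
    have := le_conj (z := S.z j) hr
    rwa [← EReal.coe_toReal hfin ((hf j).conj_ne_bot _), EReal.coe_le_coe_iff] at this
  have h2 : (conj (f j) z).toReal = inner ℝ p z - r := by
    rw [conj_eq_of_subgrad hr hsub, EReal.toReal_coe]
  have h3 : S.y j - S.s j • p = z - S.z j := by
    rw [← hy']; abel
  have h4 : phi (S.y j) (S.s j) = S.s j / 2 * ‖p‖ ^ 2 + inner ℝ p (z - S.z j) +
      ‖z - S.z j‖ ^ 2 / (2 * S.s j) := by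
    rw [phi_expand (Or.inr hs) p, h3]
  have h5 : phi (S.y j + S.z j - z) (S.s j) = S.s j / 2 * ‖p‖ ^ 2 := by
    rw [phi_expand (Or.inr hs) p, hy']
    simp
  have h6 : 1 / (2 * (Fintype.card V : ℝ)) * ‖z - S.z j‖ ^ 2 ≤ ‖z - S.z j‖ ^ 2 / (2 * S.s j) := by
    rw [div_eq_mul_one_div _ (2 * S.s j), mul_comm]
    have := hS.node_le hε j
    gcongr
  unfold State.realVal
  rw [State.quadPart_prox, h4, h5,
    sum_eq_add_sub (g := fun i => (conj (f i) (S.z i)).toReal) j fun i hi => by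
      simp [State.prox, hi]]
  have h7 : (S.prox j z).z j = z := by simp [State.prox]
  rw [h7, h2]
  rw [inner_sub_right]
  linarith

theorem conj_prox_ne_top {f : V → Vec m → EReal} {j : V} (hf : IsClosedProperConvex (f j))
    {S : State E m} (hs : 0 < S.s j) {z : Vec m} (hz : IsMinOn (S.proxObj f j) Set.univ z) :
    conj (f j) ((S.prox j z).z j) ≠ ⊤ := by
  obtain ⟨r, hr, hsub⟩ := isSubgrad_prox hf hs hz
  have h7 : (S.prox j z).z j = z := by simp [State.prox]
  rw [h7, conj_eq_of_subgrad hr hsub]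
  exact EReal.coe_ne_top _

end Steps

/-! ### `Val` as a function of the state, and existence of compatible pair variables -/

section Value

set_option linter.unusedSectionVars false

variable {V : Type*} [Fintype V] [DecidableEq V] {E : Finset (V × V)} {m : ℕ}

theorem sum_ne_bot {ι : Type*} (t : Finset ι) {g : ι → EReal} (h : ∀ i, g i ≠ ⊥) :
    ∑ i ∈ t, g i ≠ ⊥ := by
  classical
  induction t using Finset.induction_on with
  | empty => simp
  | insert i t hi ih =>
    rw [Finset.sum_insert hi]
    simp [EReal.add_eq_bot_iff, h i, ih]

/-- The pair variables enter `Val` only through indicators that vanish, so all compatible choices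
give the same value. -/
theorem Val_eq {mbar : Vec m} {f : V → Vec m → EReal} {S : State E m}
    {zF : pairs E → ProdSpace E m} (h : Compatible mbar S zF) :
    Val f (S.tuple zF) = ∑ i, conj (f i) (S.z i) + (S.quadPart : EReal) := by
  unfold Val
  have h1 : ∀ i, conj (lift (E := E) f i) ((S.tuple zF).z (Sum.inl i)) = conj (f i) (S.z i) :=
    fun i => conj_lift_single f i (S.z i)
  have h2 : ∀ b : pairs E, indic ((hyper m b.1)ᗮ : Set (ProdSpace E m))
      ((S.tuple zF).z (Sum.inr b)) = 0 := fun b => indic_of_mem (h.mem_orthogonal b)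
  have h3 : ∀ (s : ℝ) (y : Vec m), s / 2 * ‖s⁻¹ • y‖ ^ 2 = phi y s := by
    intro s y
    unfold phi
    rw [norm_smul, mul_pow, norm_inv, Real.norm_eq_abs, inv_pow, sq_abs]
    by_cases hs : s = 0
    · simp [hs]
    · field_simp
  simp only [h1, h2, Finset.sum_const_zero, add_zero, ← coe_sum_real]
  congr 2
  rw [Fintype.sum_sum_type]
  unfold State.quadPart
  congr 1
  · exact Finset.sum_congr rfl fun i _ => h3 (S.s i) (S.y i)
  · exact Finset.sum_congr rfl fun e _ => h3 (S.edgeS e) (S.edgeY e)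

theorem Val_eq_realVal {mbar : Vec m} {f : V → Vec m → EReal}
    (hf : ∀ i, IsClosedProperConvex (f i)) {S : State E m}
    {zF : pairs E → ProdSpace E m} (h : Compatible mbar S zF) (hfin : S.IsFinite f) :
    Val f (S.tuple zF) = (S.realVal f : EReal) := by
  rw [Val_eq h, State.realVal, EReal.coe_add, coe_sum_real]
  congr 1
  exact Finset.sum_congr rfl fun i _ => (EReal.coe_toReal (hfin i) ((hf i).conj_ne_bot _)).symm

theorem Val_eq_top {mbar : Vec m} {f : V → Vec m → EReal}
    (hf : ∀ i, IsClosedProperConvex (f i)) {S : State E m}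
    {zF : pairs E → ProdSpace E m} (h : Compatible mbar S zF) (hfin : ¬ S.IsFinite f) :
    Val f (S.tuple zF) = ⊤ := by
  rw [Val_eq h]
  unfold State.IsFinite at hfin
  push Not at hfin
  obtain ⟨i, hi⟩ := hfin
  rw [← Finset.add_sum_erase _ _ (Finset.mem_univ i), hi,
    EReal.top_add_of_ne_bot (sum_ne_bot _ fun j => (hf j).conj_ne_bot _),
    EReal.top_add_coe]

/-- Compatible dual variables exist. -/
theorem exists_compatible [Nonempty V] (hE : StronglyConnected E) {mbar : Vec m} {ε : ℝ}
    {S : State E m} (h : S.Inv mbar ε) :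
    ∃ zF : pairs E → ProdSpace E m, Compatible mbar S zF ∧
      ∀ b : pairs E, none ∈ b.1 → zF b = 0 := by
  -- The vector the pair variables must add up to. Its sum vanishes by the conservation laws, and
  -- its component at the extra index is zero because `s` and `y` are zero there.
  set w : ProdSpace E m := WithLp.toLp 2 (fun a => S.sAll a • mbar - S.yAll a) -
    ∑ i, single E (node i) (S.z i) with hw
  have hwsum : ∑ a, w a = 0 := by
    simp only [hw, PiLp.sub_apply, Finset.sum_sub_distrib, WithLp.ofLp_sum, Finset.sum_apply]
    rw [Finset.sum_comm (f := fun a i => single E (node i) (S.z i) a), ← Finset.sum_smul]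
    have h1 : ∑ a, S.sAll a = Fintype.card V := by
      rw [← h.sum_s, Fintype.sum_option, Fintype.sum_sum_type]
      exact zero_add _
    have h2 : ∑ a, S.yAll a = ∑ i, S.y i + ∑ e, S.edgeY e := by
      rw [Fintype.sum_option, Fintype.sum_sum_type]
      exact zero_add _
    rw [h1, h2, ← h.sum_y]
    simp [single_apply]
  have hw0 : w none = 0 := by
    simp [hw, single_apply, State.sAll, State.yAll]
  obtain ⟨zF, h1, h2, h3⟩ := isPairSum_inner hE hwsum hw0
  refine ⟨zF, ⟨h1, fun a ha => ?_⟩, fun b hb => h2 b fun hb' => hb' hb⟩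
  have hsum : ∑ c, (S.tuple zF).z c = WithLp.toLp 2 (fun a => S.sAll a • mbar - S.yAll a) := by
    rw [Fintype.sum_sum_type]
    change ∑ i, single E (node i) (S.z i) + ∑ b, zF b = _
    rw [h3, hw]
    abel
  rw [hsum, State.xAll]
  change mbar - (S.sAll a)⁻¹ • (S.sAll a • mbar - S.yAll a) = _
  rw [smul_sub, inv_smul_smul₀ ha.ne', sub_sub_cancel]

end Value

/-! ### Sequences with vanishing increments -/

section Recurrence

/-- The sequence `a` is quantified last, so that the threshold for `l` is uniform in `a`; this
permits sequences that depend on `l`, such as the distance to the position at time `l`. -/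
theorem drift_bound {d : ℕ → ℝ} (hd : Tendsto d atTop (𝓝 0)) (K : ℕ) {δ : ℝ} (hδ : 0 < δ) :
    ∀ᶠ l in atTop, ∀ k, l ≤ k → k ≤ l + K → ∀ a : ℕ → ℝ, (∀ t, a (t + 1) ≤ a t + d t) →
      a k ≤ a l + δ := by
  have hK : 0 < δ / (K + 1) := by positivity
  obtain ⟨n, hn⟩ := eventually_atTop.1 (hd.eventually (gt_mem_nhds hK))
  filter_upwards [eventually_ge_atTop n] with l hl k hlk hkl a ha
  obtain ⟨j, rfl⟩ := Nat.exists_eq_add_of_le hlk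
  have h : ∀ j : ℕ, a (l + j) ≤ a l + j * (δ / (K + 1)) := by
    intro j
    induction j with
    | zero => simp
    | succ j ih =>
      have h1 := ha (l + j)
      have h2 := hn (l + j) (by omega)
      rw [← add_assoc]
      push_cast
      linarith
  refine (h j).trans ?_
  have hj : (j : ℝ) ≤ K + 1 := by
    have : j ≤ K + 1 := by omega
    exact_mod_cast this
  have h1 : (j : ℝ) * (δ / (K + 1)) ≤ (K + 1) * (δ / (K + 1)) := by gcongr
  have h2 : ((K : ℝ) + 1) * (δ / (K + 1)) = δ := by field_simp
  linarith

/-- A nonnegative sequence with vanishing increments that is small at recurrent times tends to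
zero. -/
theorem tendsto_zero_of_recurrent {a b d : ℕ → ℝ} (ha : ∀ k, 0 ≤ a k)
    (hd : Tendsto d atTop (𝓝 0)) (hstep : ∀ k, a (k + 1) ≤ a k + d k)
    (hb : Tendsto b atTop (𝓝 0)) (K : ℕ)
    (hrec : ∀ᶠ k in atTop, ∃ l, k ≤ l ∧ l ≤ k + K ∧ a l ≤ b l) : Tendsto a atTop (𝓝 0) := by
  rw [Metric.tendsto_atTop]
  intro δ hδ
  obtain ⟨n, hn⟩ := eventually_atTop.1 ((drift_bound hd K (half_pos hδ)).and
    ((hb.eventually (gt_mem_nhds (half_pos hδ))).and hrec))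
  refine ⟨n + K, fun k hk => ?_⟩
  obtain ⟨l, hl1, hl2, hl3⟩ := (hn (k - K) (by omega)).2.2
  obtain ⟨h1, h2, -⟩ := hn l (by omega)
  have h3 := h1 k (by omega) (by omega) a hstep
  rw [Real.dist_0_eq_abs, abs_of_nonneg (ha k)]
  linarith

theorem le_sqrt_div {c a δ : ℝ} (hc : 0 < c) (h : c * a ^ 2 ≤ δ) : a ≤ √(δ / c) := by
  refine (le_abs_self a).trans (Real.abs_le_sqrt ?_)
  rw [le_div_iff₀ hc]
  linarith

theorem tendsto_sqrt_div {c : ℝ} {δ : ℕ → ℝ} (h : Tendsto δ atTop (𝓝 0)) :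
    Tendsto (fun k => √(δ k / c)) atTop (𝓝 0) := by
  have := (h.div_const c).sqrt
  simpa using this

end Recurrence

/-! ### Vanishing movement, consensus, and approximate subgradients along a run -/

section Run

set_option linter.unusedSectionVars false

variable {V : Type*} [Fintype V] [DecidableEq V] {E : Finset (V × V)} {m : ℕ}

/-- The constant in the estimates of the decrease of the objective. -/
noncomputable def rate (V : Type*) [Fintype V] (ε : ℝ) : ℝ := ε / (2 * (Fintype.card V : ℝ) ^ 2)

theorem rate_pos [Nonempty V] {ε : ℝ} (hε : 0 < ε) : 0 < rate V ε := by
  have hN : 0 < (Fintype.card V : ℝ) := by exact_mod_cast Fintype.card_pos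
  unfold rate
  positivity

/-- A run of the algorithm under the assumptions of the convergence theorem. -/
structure IsGoodRun (f : V → Vec m → EReal) (mbar : Vec m) (ε : ℝ) (K : ℕ) (op : ℕ → Op E)
    (S : ℕ → State E m) : Prop extends IsRun f mbar op S where
  connected : StronglyConnected E
  convex : ∀ i, IsClosedProperConvex (f i)
  pos : 0 < ε
  weight : ∀ k i, ε < (S k).s i
  bounded : ∃ M : ℝ, ∀ k i, ‖(S k).z i‖ ≤ M
  opA : ∀ k, ∀ i : V, ∃ l, k ≤ l ∧ l < k + K ∧ op l = Op.A i
  opC : ∀ k, ∀ i : V, ∃ l, k ≤ l ∧ l < k + K ∧ op l = Op.C i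
  opB : ∀ k, ∀ e : E, ∃ l, k ≤ l ∧ l < k + K ∧ op l = Op.B e

namespace IsGoodRun

variable {f : V → Vec m → EReal} {mbar : Vec m} {ε : ℝ} {K : ℕ} {op : ℕ → Op E}
  {S : ℕ → State E m}

theorem step_A (h : IsGoodRun f mbar ε K op S) {k : ℕ} {i : V} (hk : op k = Op.A i) :
    S (k + 1) = (S k).send i := by
  have := h.step k
  rwa [hk] at this

theorem step_B (h : IsGoodRun f mbar ε K op S) {k : ℕ} {e : E} (hk : op k = Op.B e) :
    S (k + 1) = (S k).receive e := by
  have := h.step k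
  rwa [hk] at this

theorem step_C (h : IsGoodRun f mbar ε K op S) {k : ℕ} {j : V} (hk : op k = Op.C j) :
    ∃ z, IsMinOn ((S k).proxObj f j) Set.univ z ∧ S (k + 1) = (S k).prox j z := by
  have := h.step k
  rw [hk] at this
  obtain ⟨z, hz, hS⟩ := this
  exact ⟨z, hz, hS.trans ((S k).prox_eq j (h.pos.trans (h.weight k j)).ne' z)⟩

theorem inv (h : IsGoodRun f mbar ε K op S) (k : ℕ) : (S k).Inv mbar ε := by
  induction k with
  | zero => exact h.init.inv (h.weight 0)
  | succ k ih =>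
    rcases hk : op k with i | e | j
    · have hS := h.step_A hk
      rw [hS]
      exact ih.send h.pos i (hS ▸ h.weight (k + 1))
    · have hS := h.step_B hk
      rw [hS]
      exact ih.receive e (hS ▸ h.weight (k + 1))
    · obtain ⟨z, -, hS⟩ := h.step_C hk
      rw [hS]
      exact ih.prox j z

theorem conj_ne_top_succ (h : IsGoodRun f mbar ε K op S) {k : ℕ} {i : V}
    (hfin : conj (f i) ((S k).z i) ≠ ⊤) : conj (f i) ((S (k + 1)).z i) ≠ ⊤ := by
  rcases hk : op k with a | e | j
  · rw [h.step_A hk]; exact hfin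
  · rw [h.step_B hk]; exact hfin
  · obtain ⟨z, hz, hS⟩ := h.step_C hk
    rw [hS]
    by_cases hij : i = j
    · subst hij
      exact conj_prox_ne_top (h.convex i) (h.pos.trans (h.weight k i)) hz
    · simpa [State.prox, hij] using hfin

theorem isFinite_succ (h : IsGoodRun f mbar ε K op S) {k : ℕ} (hfin : (S k).IsFinite f) :
    (S (k + 1)).IsFinite f := fun i => h.conj_ne_top_succ (hfin i)

/-- From time `K` on the conjugates are finite. -/
theorem isFinite (h : IsGoodRun f mbar ε K op S) {k : ℕ} (hk : K ≤ k) : (S k).IsFinite f := by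
  intro i
  obtain ⟨l, -, hl, hop⟩ := h.opC 0 i
  have key : ∀ n, conj (f i) ((S (l + 1 + n)).z i) ≠ ⊤ := by
    intro n
    induction n with
    | zero =>
      obtain ⟨z, hz, hS⟩ := h.step_C hop
      rw [add_zero, hS]
      exact conj_prox_ne_top (h.convex i) (h.pos.trans (h.weight l i)) hz
    | succ n ih => exact h.conj_ne_top_succ ih
  obtain ⟨n, rfl⟩ := Nat.exists_eq_add_of_le (show l + 1 ≤ k by omega)
  exact key n

theorem decrease_send (h : IsGoodRun f mbar ε K op S) [Nonempty V] {k : ℕ} {i : V}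
    (hk : op k = Op.A i) (e : E) (he : e.1.1 = i) :
    rate V ε * ‖(S k).edgeY e - (S k).edgeS e • (S k).nodeX i‖ ^ 2 ≤
      (S k).realVal f - (S (k + 1)).realVal f := by
  have hS := h.step_A hk
  have h1 := (h.inv k).quadPart_send h.pos i (hS ▸ h.weight (k + 1) i)
  have h2 : ∀ e' : E, 0 ≤ (if e'.1.1 = i then ε / (2 * (Fintype.card V : ℝ) ^ 2) *
      ‖(S k).edgeY e' - (S k).edgeS e' • (S k).nodeX i‖ ^ 2 else 0) := by
    intro e'
    have := (rate_pos (V := V) h.pos).le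
    unfold rate at this
    split_ifs <;> positivity
  have h3 := Finset.single_le_sum (fun e' _ => h2 e') (Finset.mem_univ e)
  rw [if_pos he] at h3
  rw [hS, State.realVal, State.realVal]
  change _ ≤ _ - (∑ i, (conj (f i) ((S k).z i)).toReal + _)
  unfold rate
  linarith

theorem decrease_receive (h : IsGoodRun f mbar ε K op S) {k : ℕ} {e : E} (hk : op k = Op.B e) :
    rate V ε * ‖(S k).edgeY e - (S k).edgeS e • (S k).nodeX e.1.2‖ ^ 2 ≤
      (S k).realVal f - (S (k + 1)).realVal f := by
  have h1 := (h.inv k).quadPart_receive h.pos e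
  rw [h.step_B hk, State.realVal, State.realVal]
  change _ ≤ _ - (∑ i, (conj (f i) ((S k).z i)).toReal + _)
  unfold rate
  linarith

/-- Holds because `ε < s_i ≤ |V|`; it lets one constant serve all three operations. -/
theorem rate_le (h : IsGoodRun f mbar ε K op S) [Nonempty V] :
    rate V ε ≤ 1 / (2 * (Fintype.card V : ℝ)) := by
  have hN : 0 < (Fintype.card V : ℝ) := by exact_mod_cast Fintype.card_pos
  obtain ⟨i⟩ := ‹Nonempty V›
  have h1 : ε ≤ Fintype.card V := (h.weight 0 i).le.trans ((h.inv 0).node_le h.pos i)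
  unfold rate
  rw [div_le_div_iff₀ (by positivity) (by positivity)]
  nlinarith

/-- The movement of the points `x_i` is controlled by the decrease of the objective. -/
theorem decrease_nodeX (h : IsGoodRun f mbar ε K op S) [Nonempty V] {k : ℕ}
    (hfin : (S k).IsFinite f) (i : V) :
    rate V ε * ε ^ 2 * ‖(S (k + 1)).nodeX i - (S k).nodeX i‖ ^ 2 ≤
      (S k).realVal f - (S (k + 1)).realVal f := by
  have hε := h.pos
  have hr := rate_pos (V := V) hε
  have hdec : 0 ≤ (S k).realVal f - (S (k + 1)).realVal f := by
    rcases hk : op k with a | e | j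
    · have h1 := (h.inv k).quadPart_send h.pos a (h.step_A hk ▸ h.weight (k + 1) a)
      have h2 : 0 ≤ ∑ e' : E, (if e'.1.1 = a then ε / (2 * (Fintype.card V : ℝ) ^ 2) *
          ‖(S k).edgeY e' - (S k).edgeS e' • (S k).nodeX a‖ ^ 2 else 0) := by
        refine Finset.sum_nonneg fun e' _ => ?_
        split_ifs <;> positivity
      rw [h.step_A hk, State.realVal, State.realVal]
      change _ ≤ _ - (∑ i, (conj (f i) ((S k).z i)).toReal + _)
      linarith
    · exact le_trans (by positivity) (h.decrease_receive hk)
    · obtain ⟨z, hz, hS⟩ := h.step_C hk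
      have := realVal_prox h.convex (h.inv k) hε (hfin j) hz
      rw [hS]
      have h2 : 0 ≤ 1 / (2 * (Fintype.card V : ℝ)) * ‖z - (S k).z j‖ ^ 2 := by positivity
      linarith
  rcases hk : op k with a | e | j
  · rw [h.step_A hk, send_nodeX, sub_self, norm_zero]
    rw [h.step_A hk] at hdec
    simpa using hdec
  · by_cases hi : i = e.1.2
    · refine le_trans ?_ (h.decrease_receive hk)
      have hs := h.weight k i
      have hs0 : 0 < (S k).s i := hε.trans hs
      have he := (h.inv k).edge_nonneg hε e
      have hpos : 0 < (S k).s i + (S k).edgeS e := by linarith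
      -- The receiver moves by the disagreement divided by its new weight; that weight exceeds `ε`,
      -- which accounts for the factor `ε ^ 2`.
      have h1 : (S (k + 1)).nodeX i - (S k).nodeX i = ((S k).s i + (S k).edgeS e)⁻¹ •
          ((S k).edgeY e - (S k).edgeS e • (S k).nodeX i) := by
        have h2 : (S k).y i = (S k).s i • (S k).nodeX i := by
          rw [State.nodeX, smul_inv_smul₀ hs0.ne']
        have h3 : (S (k + 1)).nodeX i =
            ((S k).s i + (S k).edgeS e)⁻¹ • ((S k).y i + (S k).edgeY e) := by
          rw [State.nodeX, h.step_B hk, hi, receive_s, receive_y]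
        rw [h3, eq_inv_smul_iff₀ hpos.ne', smul_sub, smul_inv_smul₀ hpos.ne', h2, add_smul]
        abel
      rw [h1, norm_smul, norm_inv, Real.norm_of_nonneg hpos.le, ← hi, mul_pow, mul_assoc]
      refine mul_le_mul_of_nonneg_left ?_ hr.le
      rw [← mul_assoc]
      refine mul_le_of_le_one_left (by positivity) ?_
      rw [inv_pow, ← div_eq_mul_inv, div_le_one (by positivity)]
      exact pow_le_pow_left₀ hε.le (by linarith) 2
    · have : (S (k + 1)).nodeX i = (S k).nodeX i := by
        rw [State.nodeX, h.step_B hk, receive_s_of_ne _ _ hi, receive_y_of_ne _ _ hi, State.nodeX]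
      rw [this, sub_self, norm_zero]
      simpa using hdec
  · obtain ⟨z, hz, hS⟩ := h.step_C hk
    by_cases hi : i = j
    · subst hi
      have h1 := realVal_prox h.convex (h.inv k) hε (hfin i) hz
      rw [hS]
      have hs := h.weight k i
      have hs0 : 0 < (S k).s i := hε.trans hs
      have h2 : ((S k).prox i z).nodeX i - (S k).nodeX i = -(((S k).s i)⁻¹ • (z - (S k).z i)) := by
        simp only [State.nodeX, State.prox, Function.update_self, ← smul_sub, ← smul_neg]
        congr 1
        abel
      rw [h2, norm_neg, norm_smul, norm_inv, Real.norm_of_nonneg hs0.le]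
      have h3 : rate V ε * ε ^ 2 * (((S k).s i)⁻¹ * ‖z - (S k).z i‖) ^ 2 ≤
          1 / (2 * (Fintype.card V : ℝ)) * ‖z - (S k).z i‖ ^ 2 := by
        rw [mul_pow, mul_assoc]
        refine mul_le_mul h.rate_le ?_ (by positivity) (by positivity)
        rw [← mul_assoc]
        refine mul_le_of_le_one_left (by positivity) ?_
        rw [inv_pow, ← div_eq_mul_inv, div_le_one (by positivity)]
        exact pow_le_pow_left₀ hε.le hs.le 2
      linarith
    · have : (S (k + 1)).nodeX i = (S k).nodeX i := by
        rw [State.nodeX, hS]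
        simp [State.prox, hi, State.nodeX]
      rw [this, sub_self, norm_zero]
      simpa using hdec

theorem realVal_succ_le (h : IsGoodRun f mbar ε K op S) [Nonempty V] {k : ℕ}
    (hfin : (S k).IsFinite f) : (S (k + 1)).realVal f ≤ (S k).realVal f := by
  obtain ⟨i⟩ := ‹Nonempty V›
  have : Nonempty V := ⟨i⟩
  have h1 := h.decrease_nodeX hfin i
  have h2 := rate_pos (V := V) h.pos
  have h3 : 0 ≤ rate V ε * ε ^ 2 * ‖(S (k + 1)).nodeX i - (S k).nodeX i‖ ^ 2 := by positivity
  linarith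

theorem antitone_Val (h : IsGoodRun f mbar ε K op S) [Nonempty V]
    {zF : ℕ → pairs E → ProdSpace E m} (hzF : ∀ k, Compatible mbar (S k) (zF k)) :
    Antitone (fun k => Val f ((S k).tuple (zF k))) := by
  refine antitone_nat_of_succ_le fun k => ?_
  by_cases hfin : (S k).IsFinite f
  · rw [Val_eq_realVal h.convex (hzF k) hfin,
      Val_eq_realVal h.convex (hzF (k + 1)) (h.isFinite_succ hfin), EReal.coe_le_coe_iff]
    exact h.realVal_succ_le hfin
  · rw [Val_eq_top h.convex (hzF k) hfin]
    exact le_top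

/-- Fenchel–Young at a fixed point of the domain of each `f i` bounds its conjugate below on the
bounded set containing the `z i`. -/
theorem exists_realVal_ge (h : IsGoodRun f mbar ε K op S) :
    ∃ B : ℝ, ∀ k, K ≤ k → B ≤ (S k).realVal f := by
  obtain ⟨M, hM⟩ := h.bounded
  choose x c hx using fun i => (h.convex i).exists_real
  refine ⟨∑ i, (-(‖x i‖ * M) - c i), fun k hk => ?_⟩
  unfold State.realVal
  refine le_add_of_le_of_nonneg (Finset.sum_le_sum fun i _ => ?_) ((h.inv k).quadPart_nonneg h.pos)
  have h1 := le_conj (z := (S k).z i) (hx i)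
  rw [← EReal.coe_toReal (h.isFinite hk i) ((h.convex i).conj_ne_bot _), EReal.coe_le_coe_iff] at h1
  have h2 := neg_le_of_abs_le (abs_real_inner_le_norm (x i) ((S k).z i))
  have h3 := mul_le_mul_of_nonneg_left (hM k i) (norm_nonneg (x i))
  linarith

theorem exists_tendsto_realVal (h : IsGoodRun f mbar ε K op S) [Nonempty V] :
    ∃ L : ℝ, Tendsto (fun k => (S k).realVal f) atTop (𝓝 L) := by
  obtain ⟨B, hB⟩ := h.exists_realVal_ge
  have h1 : Antitone (fun k => (S (k + K)).realVal f) := by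
    refine antitone_nat_of_succ_le fun k => ?_
    rw [add_right_comm]
    exact h.realVal_succ_le (h.isFinite (by omega))
  have h2 : BddBelow (Set.range fun k => (S (k + K)).realVal f) :=
    ⟨B, by rintro _ ⟨k, rfl⟩; exact hB _ (by omega)⟩
  exact ⟨_, (tendsto_add_atTop_iff_nat (f := fun k => (S k).realVal f) K).1
    (tendsto_atTop_ciInf h1 h2)⟩

theorem tendsto_decrease (h : IsGoodRun f mbar ε K op S) [Nonempty V] :
    Tendsto (fun k => (S k).realVal f - (S (k + 1)).realVal f) atTop (𝓝 0) := by
  obtain ⟨L, hL⟩ := h.exists_tendsto_realVal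
  simpa using hL.sub ((tendsto_add_atTop_iff_nat 1).2 hL)

theorem tendsto_move (h : IsGoodRun f mbar ε K op S) [Nonempty V] (i : V) :
    Tendsto (fun k => ‖(S (k + 1)).nodeX i - (S k).nodeX i‖) atTop (𝓝 0) := by
  have hε := h.pos
  have hr := rate_pos (V := V) hε
  refine squeeze_zero' (Eventually.of_forall fun k => norm_nonneg _) ?_
    (tendsto_sqrt_div (c := rate V ε * ε ^ 2) h.tendsto_decrease)
  filter_upwards [eventually_ge_atTop K] with k hk
  exact le_sqrt_div (by positivity) (h.decrease_nodeX (h.isFinite hk) i)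

/-- A send by the source adds a multiple of its own point, leaving the discrepancy unchanged; a
receipt on `e` resets it to zero. Otherwise only the source point can move, and the edge weight is
at most `|V|`. -/
theorem edge_drift (h : IsGoodRun f mbar ε K op S) (e : E) (k : ℕ) :
    ‖(S (k + 1)).edgeY e - (S (k + 1)).edgeS e • (S (k + 1)).nodeX e.1.1‖ ≤
      ‖(S k).edgeY e - (S k).edgeS e • (S k).nodeX e.1.1‖ +
        (Fintype.card V : ℝ) * ‖(S (k + 1)).nodeX e.1.1 - (S k).nodeX e.1.1‖ := by
  have same : (S (k + 1)).edgeY e = (S k).edgeY e → (S (k + 1)).edgeS e = (S k).edgeS e →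
      ‖(S (k + 1)).edgeY e - (S (k + 1)).edgeS e • (S (k + 1)).nodeX e.1.1‖ ≤
      ‖(S k).edgeY e - (S k).edgeS e • (S k).nodeX e.1.1‖ +
        (Fintype.card V : ℝ) * ‖(S (k + 1)).nodeX e.1.1 - (S k).nodeX e.1.1‖ := by
    intro hy hs
    rw [hy, hs]
    have e1 : (S k).edgeY e - (S k).edgeS e • (S (k + 1)).nodeX e.1.1 =
        ((S k).edgeY e - (S k).edgeS e • (S k).nodeX e.1.1) -
          (S k).edgeS e • ((S (k + 1)).nodeX e.1.1 - (S k).nodeX e.1.1) := by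
      rw [smul_sub]; abel
    rw [e1]
    refine (norm_sub_le _ _).trans (add_le_add_right ?_ _)
    rw [norm_smul, Real.norm_of_nonneg ((h.inv k).edge_nonneg h.pos e)]
    exact mul_le_mul_of_nonneg_right ((h.inv k).edge_le h.pos e) (norm_nonneg _)
  rcases hk : op k with i | e' | j
  · have hx : (S (k + 1)).nodeX e.1.1 = (S k).nodeX e.1.1 := by
      rw [h.step_A hk, send_nodeX]
    by_cases he : e.1.1 = i
    · rw [hx, sub_self, norm_zero, mul_zero, add_zero]
      apply le_of_eq
      have hs := h.weight (k + 1) i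
      have h1 : (S (k + 1)).y i = (S (k + 1)).s i • (S k).nodeX e.1.1 := by
        rw [← hx, he, State.nodeX, smul_inv_smul₀ (h.pos.trans hs).ne']
      rw [h.step_A hk] at h1 ⊢
      rw [send_edgeY, send_edgeS, if_pos he, if_pos he, h1, add_smul]
      congr 1
      abel
    · apply same
      · rw [h.step_A hk, send_edgeY, if_neg he, add_zero]
      · rw [h.step_A hk, send_edgeS, if_neg he, add_zero]
  · by_cases he : e = e'
    · subst he
      have h1 : (S (k + 1)).edgeY e = 0 := by rw [h.step_B hk, receive_edgeY]
      have h2 : (S (k + 1)).edgeS e = 0 := by rw [h.step_B hk, receive_edgeS]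
      rw [h1, h2, zero_smul, sub_zero, norm_zero]
      positivity
    · apply same
      · rw [h.step_B hk, receive_edgeY_of_ne _ _ he]
      · rw [h.step_B hk, receive_edgeS_of_ne _ _ he]
  · obtain ⟨z, -, hS⟩ := h.step_C hk
    apply same <;> rw [hS] <;> rfl

theorem tendsto_edge_source (h : IsGoodRun f mbar ε K op S) [Nonempty V] (e : E) :
    Tendsto (fun k => ‖(S k).edgeY e - (S k).edgeS e • (S k).nodeX e.1.1‖) atTop (𝓝 0) := by
  have hr := rate_pos (V := V) h.pos
  refine tendsto_zero_of_recurrent (fun k => norm_nonneg _)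
    (by simpa using (h.tendsto_move e.1.1).const_mul (Fintype.card V : ℝ)) (h.edge_drift e)
    (tendsto_sqrt_div (c := rate V ε) h.tendsto_decrease) K (Eventually.of_forall fun k => ?_)
  obtain ⟨l, hl1, hl2, hop⟩ := h.opA k e.1.1
  exact ⟨l, hl1, hl2.le, le_sqrt_div hr (h.decrease_send hop e rfl)⟩

/-- Along every edge a message of weight at least `ε` is received again and again. -/
theorem exists_receive (h : IsGoodRun f mbar ε K op S) (e : E) (k : ℕ) :
    ∃ l, k ≤ l ∧ l ≤ k + 2 * K ∧ op l = Op.B e ∧ ε ≤ (S l).edgeS e := by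
  obtain ⟨a, ha1, ha2, hop⟩ := h.opA k e.1.1
  -- After the send at time `a` the edge carries weight at least `ε` until the first receipt on `e`.
  -- The two waiting times together give the window `2 * K`.
  have key : ∀ n, (ε ≤ (S (a + 1 + n)).edgeS e) ∨
      ∃ l, a + 1 ≤ l ∧ l < a + 1 + n ∧ op l = Op.B e ∧ ε ≤ (S l).edgeS e := by
    intro n
    induction n with
    | zero =>
      left
      have h1 := h.weight (a + 1) e.1.1
      have h2 := (h.inv a).edge_nonneg h.pos e
      rw [add_zero]
      rw [h.step_A hop] at h1 ⊢
      rw [send_edgeS, if_pos rfl]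
      linarith
    | succ n ih =>
      rcases ih with ih | ⟨l, h1, h2, h3⟩
      · rw [← add_assoc]
        rcases hk : op (a + 1 + n) with i | e' | j
        · left
          rw [h.step_A hk, send_edgeS]
          have := h.weight (a + 1 + n + 1) i
          rw [h.step_A hk] at this
          have := h.pos
          split_ifs <;> linarith
        · by_cases he : e = e'
          · subst he
            exact Or.inr ⟨a + 1 + n, by omega, by omega, hk, ih⟩
          · left
            rw [h.step_B hk, receive_edgeS_of_ne _ _ he]
            exact ih
        · left
          obtain ⟨z, -, hS⟩ := h.step_C hk
          rw [hS]
          exact ih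
      · exact Or.inr ⟨l, h1, by omega, h3⟩
  obtain ⟨b, hb1, hb2, hopb⟩ := h.opB (a + 1) e
  obtain ⟨n, rfl⟩ := Nat.exists_eq_add_of_le hb1
  rcases key n with hn | ⟨l, h1, h2, h3, h4⟩
  · exact ⟨a + 1 + n, by omega, by omega, hopb, hn⟩
  · exact ⟨l, by omega, by omega, h3, h4⟩

/-- At a receipt with edge weight at least `ε`, the message nearly agrees with the source by
`tendsto_edge_source` and with the target because the decrease is small. Subtract and divide by the
weight; slow movement covers the times in between. -/
theorem tendsto_edge_diff (h : IsGoodRun f mbar ε K op S) [Nonempty V] (e : E) :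
    Tendsto (fun k => ‖(S k).nodeX e.1.1 - (S k).nodeX e.1.2‖) atTop (𝓝 0) := by
  have hε := h.pos
  have hr := rate_pos (V := V) h.pos
  have hd := (h.tendsto_move e.1.1).add (h.tendsto_move e.1.2)
  have hb := ((tendsto_sqrt_div (c := rate V ε) h.tendsto_decrease).add
    (h.tendsto_edge_source e)).div_const ε
  simp only [add_zero, zero_div] at hd hb
  refine tendsto_zero_of_recurrent (fun k => norm_nonneg _) hd (fun k => ?_) hb (2 * K)
    (Eventually.of_forall fun k => ?_)
  · have e1 : (S (k + 1)).nodeX e.1.1 - (S (k + 1)).nodeX e.1.2 =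
        ((S k).nodeX e.1.1 - (S k).nodeX e.1.2) + (((S (k + 1)).nodeX e.1.1 - (S k).nodeX e.1.1) -
          ((S (k + 1)).nodeX e.1.2 - (S k).nodeX e.1.2)) := by abel
    rw [e1]
    exact (norm_add_le _ _).trans (add_le_add_right (norm_sub_le _ _) _)
  · obtain ⟨l, h1, h2, h3, h4⟩ := h.exists_receive e k
    refine ⟨l, h1, h2, ?_⟩
    rw [le_div_iff₀ hε]
    have h5 := le_sqrt_div hr (h.decrease_receive h3)
    have e2 : (S l).edgeS e • ((S l).nodeX e.1.1 - (S l).nodeX e.1.2) =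
        ((S l).edgeY e - (S l).edgeS e • (S l).nodeX e.1.2) -
          ((S l).edgeY e - (S l).edgeS e • (S l).nodeX e.1.1) := by
      rw [smul_sub]; abel
    have h6 := (congrArg norm e2).le.trans (norm_sub_le _ _)
    rw [norm_smul, Real.norm_of_nonneg (hε.le.trans h4)] at h6
    have h7 := mul_le_mul_of_nonneg_right h4
      (norm_nonneg ((S l).nodeX e.1.1 - (S l).nodeX e.1.2))
    linarith

theorem tendsto_diff (h : IsGoodRun f mbar ε K op S) [Nonempty V] (i j : V) :
    Tendsto (fun k => (S k).nodeX i - (S k).nodeX j) atTop (𝓝 0) := by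
  induction h.connected i j with
  | refl => simp
  | @tail b c _ hbc ih =>
    have h1 := tendsto_zero_iff_norm_tendsto_zero.2 (h.tendsto_edge_diff (⟨(b, c), hbc⟩ : E))
    simpa using ih.add h1

/-- At late times every `z_i` is a subgradient at some recent `x_i`. -/
theorem exists_subgrad (h : IsGoodRun f mbar ε K op S) (i : V) {k : ℕ} (hk : K ≤ k) :
    ∃ l, l ≤ k ∧ k ≤ l + K ∧ IsSubgrad (f i) ((S l).nodeX i) ((S k).z i) := by
  obtain ⟨a, ha1, ha2, hop⟩ := h.opC (k - K) i
  have key : ∀ n, ∃ l, a + 1 ≤ l ∧ l ≤ a + 1 + n ∧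
      IsSubgrad (f i) ((S l).nodeX i) ((S (a + 1 + n)).z i) := by
    have hC : ∀ k, op k = Op.C i → IsSubgrad (f i) ((S (k + 1)).nodeX i) ((S (k + 1)).z i) := by
      intro k hop
      obtain ⟨z, hz, hS⟩ := h.step_C hop
      rw [hS]
      convert isSubgrad_prox (h.convex i) (h.pos.trans (h.weight k i)) hz using 1
      simp [State.prox]
    intro n
    induction n with
    | zero => exact ⟨a + 1, le_rfl, le_rfl, hC a hop⟩
    | succ n ih =>
      obtain ⟨l, h1, h2, h3⟩ := ih
      by_cases hopn : op (a + 1 + n) = Op.C i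
      · exact ⟨a + 1 + n + 1, by omega, by omega, hC _ hopn⟩
      · refine ⟨l, h1, by omega, ?_⟩
        have hz : (S (a + 1 + n + 1)).z i = (S (a + 1 + n)).z i := by
          rcases hk : op (a + 1 + n) with i' | e | j
          · rw [h.step_A hk]; rfl
          · rw [h.step_B hk]; rfl
          · obtain ⟨z, -, hS⟩ := h.step_C hk
            have hij : i ≠ j := by
              rintro rfl
              exact hopn hk
            rw [hS]
            simp [State.prox, hij]
        rw [← add_assoc, hz]
        exact h3
  obtain ⟨n, rfl⟩ := Nat.exists_eq_add_of_le (show a + 1 ≤ k by omega)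
  obtain ⟨l, h1, h2, h3⟩ := key n
  exact ⟨l, h2, by omega, h3⟩

theorem exists_subgrad_seq (h : IsGoodRun f mbar ε K op S) [Nonempty V] (i : V) :
    ∃ p : ℕ → Vec m, (∀ k, K ≤ k → IsSubgrad (f i) (p k) ((S k).z i)) ∧
      Tendsto (fun k => p k - (S k).nodeX i) atTop (𝓝 0) := by
  have h1 : ∀ k, ∃ l, K ≤ k → l ≤ k ∧ k ≤ l + K ∧
      IsSubgrad (f i) ((S l).nodeX i) ((S k).z i) := by
    intro k
    by_cases hk : K ≤ k
    · obtain ⟨l, hl⟩ := h.exists_subgrad i hk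
      exact ⟨l, fun _ => hl⟩
    · exact ⟨0, fun hk' => absurd hk' hk⟩
  choose l hl using h1
  refine ⟨fun k => (S (l k)).nodeX i, fun k hk => (hl k hk).2.2, ?_⟩
  rw [Metric.tendsto_atTop]
  intro δ hδ
  obtain ⟨n, hn⟩ := eventually_atTop.1 (drift_bound (h.tendsto_move i) K (half_pos hδ))
  refine ⟨n + K, fun k hk => ?_⟩
  obtain ⟨h2, h3, -⟩ := hl k (by omega)
  have h4 := hn (l k) (by omega) k h2 h3 (fun t => ‖(S t).nodeX i - (S (l k)).nodeX i‖) (fun t => by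
    have := norm_add_le ((S (t + 1)).nodeX i - (S t).nodeX i)
      ((S t).nodeX i - (S (l k)).nodeX i)
    rw [sub_add_sub_cancel] at this
    linarith)
  rw [dist_zero_right, norm_sub_rev]
  simp only [sub_self, norm_zero, zero_add] at h4
  linarith

end IsGoodRun

end Run

/-! ### Identification of the limit and convergence of the whole sequence -/

section Convergence

set_option linter.unusedSectionVars false

variable {V : Type*} [Fintype V] [DecidableEq V] {E : Finset (V × V)} {m : ℕ}

/-- Sum `phi_expand` over nodes and edges: the conservation laws evaluate the first two terms, so
the dependence on the individual weights is confined to nonnegative remainders. -/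
theorem State.Inv.quadPart_expand {mbar : Vec m} {ε : ℝ} {S : State E m} (h : S.Inv mbar ε)
    (hε : 0 < ε) (x : Vec m) :
    S.quadPart = (Fintype.card V : ℝ) / 2 * ‖x‖ ^ 2 +
      inner ℝ x ((Fintype.card V : ℝ) • (mbar - x) - ∑ i, S.z i) +
      (∑ i, ‖S.y i - S.s i • x‖ ^ 2 / (2 * S.s i) +
        ∑ e, ‖S.edgeY e - S.edgeS e • x‖ ^ 2 / (2 * S.edgeS e)) := by
  have h1 : ∑ i, (S.y i - S.s i • x) + ∑ e, (S.edgeY e - S.edgeS e • x) =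
      (Fintype.card V : ℝ) • (mbar - x) - ∑ i, S.z i := by
    rw [smul_sub, ← h.sum_y, ← h.sum_s, Finset.sum_sub_distrib, Finset.sum_sub_distrib, add_smul,
      Finset.sum_smul, Finset.sum_smul]
    abel
  unfold State.quadPart
  rw [Finset.sum_congr rfl fun i _ => phi_expand (Or.inr (hε.trans (h.node i))) x,
    Finset.sum_congr rfl fun e _ => phi_expand (h.edge_cases hε e) x, ← h1, ← h.sum_s]
  simp only [Finset.sum_add_distrib, ← Finset.sum_mul, ← Finset.sum_div, inner_add_right,
    ← inner_sum]
  ring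

theorem State.Inv.y_sub {mbar : Vec m} {ε : ℝ} {S : State E m} (h : S.Inv mbar ε)
    (hε : 0 < ε) (x : Vec m) (i : V) : S.y i - S.s i • x = S.s i • (S.nodeX i - x) := by
  rw [smul_sub, State.nodeX, smul_inv_smul₀ (hε.trans (h.node i)).ne']

/-- The distance to the optimal value controls the distance to the primal solution. -/
theorem State.Inv.realVal_ge {mbar : Vec m} {ε : ℝ} {S : State E m} (h : S.Inv mbar ε)
    (hε : 0 < ε) {f : V → Vec m → EReal} (hf : ∀ i, IsClosedProperConvex (f i))
    (hfin : S.IsFinite f) {x : Vec m} {r : V → ℝ} (hr : ∀ i, f i x = r i) (i : V) :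
    optValue mbar x r + ε / 2 * ‖S.nodeX i - x‖ ^ 2 ≤ S.realVal f := by
  have h1 : ∑ i, (inner ℝ x (S.z i) - r i) ≤ ∑ i, (conj (f i) (S.z i)).toReal := by
    refine Finset.sum_le_sum fun j _ => ?_
    have := le_conj (z := S.z j) (hr j)
    rwa [← EReal.coe_toReal (hfin j) ((hf j).conj_ne_bot _), EReal.coe_le_coe_iff] at this
  have h2 : ε / 2 * ‖S.nodeX i - x‖ ^ 2 ≤ ∑ i, ‖S.y i - S.s i • x‖ ^ 2 / (2 * S.s i) := by
    have h3 : ∀ j, 0 < S.s j := fun j => hε.trans (h.node j)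
    refine le_trans ?_ (Finset.single_le_sum (f := fun i => ‖S.y i - S.s i • x‖ ^ 2 / (2 * S.s i))
      (fun j _ => ?_) (Finset.mem_univ i))
    · have hi := h3 i
      rw [h.y_sub hε, norm_smul, Real.norm_of_nonneg hi.le]
      have e1 : (S.s i * ‖S.nodeX i - x‖) ^ 2 / (2 * S.s i) = S.s i / 2 * ‖S.nodeX i - x‖ ^ 2 := by
        field_simp
      rw [e1]
      have := (h.node i).le
      gcongr
    · have hj := h3 j
      positivity
  have h4 : 0 ≤ ∑ e, ‖S.edgeY e - S.edgeS e • x‖ ^ 2 / (2 * S.edgeS e) := by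
    refine Finset.sum_nonneg fun e _ => ?_
    have := h.edge_nonneg hε e
    positivity
  unfold State.realVal
  rw [h.quadPart_expand hε x]
  rw [Finset.sum_sub_distrib, ← inner_sum] at h1
  rw [inner_sub_right, inner_smul_right, inner_sub_right, real_inner_self_eq_norm_sq,
    real_inner_comm]
  unfold optValue
  linarith

namespace IsGoodRun

variable {f : V → Vec m → EReal} {mbar : Vec m} {ε : ℝ} {K : ℕ} {op : ℕ → Op E}
  {S : ℕ → State E m}

theorem tendsto_edge_node (h : IsGoodRun f mbar ε K op S) [Nonempty V] (e : E) (j : V) :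
    Tendsto (fun k => (S k).edgeY e - (S k).edgeS e • (S k).nodeX j) atTop (𝓝 0) := by
  rw [tendsto_zero_iff_norm_tendsto_zero]
  have h1 := (h.tendsto_edge_source e).add
    ((tendsto_zero_iff_norm_tendsto_zero.1 (h.tendsto_diff e.1.1 j)).const_mul (Fintype.card V : ℝ))
  simp only [mul_zero, add_zero] at h1
  refine squeeze_zero (fun k => norm_nonneg _) (fun k => ?_) h1
  have e1 : (S k).edgeY e - (S k).edgeS e • (S k).nodeX j =
      ((S k).edgeY e - (S k).edgeS e • (S k).nodeX e.1.1) +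
        (S k).edgeS e • ((S k).nodeX e.1.1 - (S k).nodeX j) := by
    rw [smul_sub]; abel
  rw [e1]
  refine (norm_add_le _ _).trans (add_le_add_right ?_ _)
  rw [norm_smul, Real.norm_of_nonneg ((h.inv k).edge_nonneg h.pos e)]
  exact mul_le_mul_of_nonneg_right ((h.inv k).edge_le h.pos e) (norm_nonneg _)

theorem tendsto_smul_of_node (h : IsGoodRun f mbar ε K op S) (i : V) {l : Filter ℕ}
    {u : ℕ → Vec m} (hu : Tendsto u l (𝓝 0)) :
    Tendsto (fun k => (S k).s i • u k) l (𝓝 0) := by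
  rw [tendsto_zero_iff_norm_tendsto_zero] at hu ⊢
  have h1 := hu.const_mul (Fintype.card V : ℝ)
  rw [mul_zero] at h1
  refine squeeze_zero (fun k => norm_nonneg _) (fun k => ?_) h1
  rw [norm_smul, Real.norm_of_nonneg (h.pos.trans (h.weight k i)).le]
  exact mul_le_mul_of_nonneg_right ((h.inv k).node_le h.pos i) (norm_nonneg _)

/-- The points `x_j` approach `m̄ - |V|⁻¹ ∑ z_i`. -/
theorem tendsto_node_sub (h : IsGoodRun f mbar ε K op S) [Nonempty V] (j : V) :
    Tendsto (fun k => (Fintype.card V : ℝ) • (mbar - (S k).nodeX j) - ∑ i, (S k).z i) atTop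
      (𝓝 0) := by
  have h1 : Tendsto (fun k => ∑ i, (S k).s i • ((S k).nodeX i - (S k).nodeX j) +
      ∑ e, ((S k).edgeY e - (S k).edgeS e • (S k).nodeX j)) atTop
      (𝓝 (∑ _i : V, 0 + ∑ _e : E, 0)) :=
    (tendsto_finsetSum _ fun i _ => h.tendsto_smul_of_node i (h.tendsto_diff i j)).add
      (tendsto_finsetSum _ fun e _ => h.tendsto_edge_node e j)
  simp only [Finset.sum_const_zero, add_zero] at h1
  refine h1.congr fun k => ?_
  have hk := h.inv k
  rw [smul_sub, ← hk.sum_y, ← hk.sum_s, add_smul, Finset.sum_smul, Finset.sum_smul,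
    ← Finset.sum_congr rfl fun i _ => hk.y_sub h.pos ((S k).nodeX j) i, Finset.sum_sub_distrib,
    Finset.sum_sub_distrib]
  abel

/-- An upper bound `G` suffices here. It replaces the weights in the denominators by `ε`, which is
legitimate for edges because a weight below `ε` is zero together with its vector. The filter `l` is
general so as to allow an ultrafilter. -/
theorem tendsto_quadPart (h : IsGoodRun f mbar ε K op S) [Nonempty V] {l : Filter ℕ}
    (hl : l ≤ atTop) {x : Vec m} (hx : ∀ i, Tendsto (fun k => (S k).nodeX i) l (𝓝 x)) :
    ∃ G : ℕ → ℝ, (∀ k, (S k).quadPart ≤ G k) ∧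
      Tendsto G l (𝓝 ((Fintype.card V : ℝ) / 2 * ‖x‖ ^ 2)) := by
  have hε := h.pos
  have hdiff : ∀ i, Tendsto (fun k => (S k).nodeX i - x) l (𝓝 0) := fun i => by
    simpa using (hx i).sub_const x
  have hnode : ∀ i, Tendsto (fun k => (S k).y i - (S k).s i • x) l (𝓝 0) := fun i =>
    (h.tendsto_smul_of_node i (hdiff i)).congr fun k => ((h.inv k).y_sub hε x i).symm
  have hedge : ∀ e, Tendsto (fun k => (S k).edgeY e - (S k).edgeS e • x) l (𝓝 0) := by
    intro e
    have h1 : Tendsto (fun k => (S k).edgeS e • ((S k).nodeX e.1.1 - x)) l (𝓝 0) := by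
      have hu := hdiff e.1.1
      rw [tendsto_zero_iff_norm_tendsto_zero] at hu ⊢
      have h1 := hu.const_mul (Fintype.card V : ℝ)
      rw [mul_zero] at h1
      refine squeeze_zero (fun k => norm_nonneg _) (fun k => ?_) h1
      rw [norm_smul, Real.norm_of_nonneg ((h.inv k).edge_nonneg hε e)]
      exact mul_le_mul_of_nonneg_right ((h.inv k).edge_le hε e) (norm_nonneg _)
    have h2 := ((h.tendsto_edge_node e e.1.1).mono_left hl).add h1
    rw [add_zero] at h2
    refine h2.congr fun k => ?_
    rw [smul_sub]; abel
  obtain ⟨j⟩ := ‹Nonempty V›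
  have : Nonempty V := ⟨j⟩
  have hinner : Tendsto (fun k => (Fintype.card V : ℝ) • (mbar - x) - ∑ i, (S k).z i) l (𝓝 0) := by
    have h1 := ((h.tendsto_node_sub j).mono_left hl).add ((hdiff j).const_smul (Fintype.card V : ℝ))
    rw [smul_zero, add_zero] at h1
    refine h1.congr fun k => ?_
    rw [smul_sub, smul_sub, smul_sub]; abel
  refine ⟨fun k => (Fintype.card V : ℝ) / 2 * ‖x‖ ^ 2 +
      inner ℝ x ((Fintype.card V : ℝ) • (mbar - x) - ∑ i, (S k).z i) +
      (∑ i, ‖(S k).y i - (S k).s i • x‖ ^ 2 / (2 * ε) +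
        ∑ e, ‖(S k).edgeY e - (S k).edgeS e • x‖ ^ 2 / (2 * ε)), fun k => ?_, ?_⟩
  · have hk := h.inv k
    rw [hk.quadPart_expand hε x]
    refine add_le_add_right (add_le_add (Finset.sum_le_sum fun i _ => ?_)
      (Finset.sum_le_sum fun e _ => ?_)) _
    · have := (hk.node i).le
      gcongr
    · rcases hk.edge e with ⟨h1, h2⟩ | h1
      · simp [h1, h2]
      · gcongr
  · have hsq : ∀ {u : ℕ → Vec m}, Tendsto u l (𝓝 0) →
        Tendsto (fun k => ‖u k‖ ^ 2 / (2 * ε)) l (𝓝 0) := by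
      intro u hu
      have := ((tendsto_zero_iff_norm_tendsto_zero.1 hu).pow 2).div_const (2 * ε)
      simpa using this
    have h1 := (((tendsto_const_nhds (x := x)).inner (𝕜 := ℝ) hinner).const_add
      ((Fintype.card V : ℝ) / 2 * ‖x‖ ^ 2)).add
      ((tendsto_finsetSum Finset.univ fun i _ => hsq (hnode i)).add
        (tendsto_finsetSum Finset.univ fun e _ => hsq (hedge e)))
    simpa using h1

/-- There is a primal-dual solution, and the algorithm converges to it. -/
theorem exists_solution (h : IsGoodRun f mbar ε K op S) [Nonempty V] :
    ∃ (x : Vec m) (z : V → Vec m) (r : V → ℝ), (∀ i, f i x = r i) ∧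
      (∀ i y, ((r i + inner ℝ (z i) (y - x) : ℝ) : EReal) ≤ f i y) ∧
      ∑ i, z i = (Fintype.card V : ℝ) • (mbar - x) ∧
      Tendsto (fun k => (S k).realVal f) atTop (𝓝 (optValue mbar x r)) ∧
      ∀ i, Tendsto (fun k => (S k).nodeX i) atTop (𝓝 x) := by
  have hε := h.pos
  have hN : (Fintype.card V : ℝ) ≠ 0 := by exact_mod_cast Fintype.card_ne_zero
  obtain ⟨M, hM⟩ := h.bounded
  set U : Ultrafilter ℕ := Ultrafilter.of atTop
  have hU : (U : Filter ℕ) ≤ atTop := Ultrafilter.of_le atTop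
  obtain ⟨z, -, hz⟩ := (isCompact_closedBall (0 : V → Vec m) (max M 0)).ultrafilter_le_nhds
    (U.map fun k => (S k).z) (by
      refine le_principal_iff.2 (Filter.mem_map.2 (Filter.univ_mem' fun k => ?_))
      simp only [Set.mem_preimage, mem_closedBall_zero_iff]
      exact (pi_norm_le_iff_of_nonneg (le_max_right _ _)).2 fun i => (hM k i).trans (le_max_left _ _))
  have hz' : Tendsto (fun k => (S k).z) U (𝓝 z) := hz
  have hzi : ∀ i, Tendsto (fun k => (S k).z i) U (𝓝 (z i)) := tendsto_pi_nhds.1 hz'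
  -- The only point compatible with `tendsto_node_sub` and the limit of the `z i`.
  set x := mbar - (Fintype.card V : ℝ)⁻¹ • ∑ i, z i with hx
  have hsum : ∑ i, z i = (Fintype.card V : ℝ) • (mbar - x) := by
    rw [hx, sub_sub_cancel, smul_inv_smul₀ hN]
  have hxU : ∀ i, Tendsto (fun k => (S k).nodeX i) U (𝓝 x) := by
    intro i
    have h1 := ((h.tendsto_node_sub i).mono_left hU).add (tendsto_finsetSum Finset.univ
      fun i _ => hzi i)
    have h2 := (h1.const_smul (Fintype.card V : ℝ)⁻¹).const_sub mbar
    rw [zero_add, ← hx] at h2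
    refine h2.congr fun k => ?_
    rw [sub_add_cancel, inv_smul_smul₀ hN, sub_sub_cancel]
  choose p hp hpx using h.exists_subgrad_seq
  have hpU : ∀ i, Tendsto (p i) U (𝓝 x) := by
    intro i
    have h1 := ((hpx i).mono_left hU).add (hxU i)
    rw [zero_add] at h1
    exact h1.congr fun k => sub_add_cancel _ _
  have hK : ∀ᶠ k in (U : Filter ℕ), K ≤ k := hU (eventually_ge_atTop K)
  have hsub : ∀ i, IsSubgrad (f i) x (z i) := fun i =>
    (h.convex i).isSubgrad_of_tendsto (hK.mono fun k hk => hp i k hk) (hpU i) (hzi i)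
  choose r hr hrz using hsub
  obtain ⟨L, hL⟩ := h.exists_tendsto_realVal
  have hge : ∀ᶠ k in atTop, ∀ i,
      optValue mbar x r + ε / 2 * ‖(S k).nodeX i - x‖ ^ 2 ≤ (S k).realVal f := by
    filter_upwards [eventually_ge_atTop K] with k hk i
    exact (h.inv k).realVal_ge hε h.convex (h.isFinite hk) hr i
  have hLge : optValue mbar x r ≤ L := by
    obtain ⟨j⟩ := ‹Nonempty V›
    refine ge_of_tendsto hL (hge.mono fun k hk => le_trans ?_ (hk j))
    have : 0 ≤ ε / 2 * ‖(S k).nodeX j - x‖ ^ 2 := by positivity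
    linarith
  obtain ⟨G, hG, hGlim⟩ := h.tendsto_quadPart hU hxU
  have hLle : L ≤ optValue mbar x r := by
    -- The conjugate at `(S k).z i` equals `⟨p, z⟩ - f p`, and the limiting subgradient bounds `f p`
    -- from below. So the conjugates are bounded above by a convergent expression without any
    -- continuity of `f`.
    have h1 : Tendsto (fun k => ∑ i, (inner ℝ (p i k) ((S k).z i) - r i -
        inner ℝ (z i) (p i k - x)) + G k) U (𝓝 (∑ i, (inner ℝ x (z i) - r i -
        inner ℝ (z i) (x - x)) + (Fintype.card V : ℝ) / 2 * ‖x‖ ^ 2)) := by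
      refine (tendsto_finsetSum _ fun i _ => ?_).add hGlim
      exact (((hpU i).inner (hzi i)).sub_const (r i)).sub
        ((tendsto_const_nhds (x := z i)).inner ((hpU i).sub_const x))
    have h2 := le_of_tendsto_of_tendsto (hL.mono_left hU) h1 (hK.mono fun k hk => by
      refine add_le_add (Finset.sum_le_sum fun i _ => ?_) (hG k)
      obtain ⟨r', hr', hs'⟩ := hp i k hk
      have h3 := hrz i (p i k)
      rw [hr', EReal.coe_le_coe_iff] at h3
      rw [conj_eq_of_subgrad hr' hs', EReal.toReal_coe]
      linarith)
    refine h2.trans (le_of_eq ?_)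
    simp only [sub_self, inner_zero_right, sub_zero]
    rw [Finset.sum_sub_distrib, ← inner_sum, hsum, inner_smul_right, inner_sub_right,
      real_inner_self_eq_norm_sq, real_inner_comm]
    unfold optValue
    ring
  have hLeq : L = optValue mbar x r := le_antisymm hLle hLge
  rw [hLeq] at hL
  refine ⟨x, z, r, hr, hrz, hsum, hL, fun i => ?_⟩
  rw [tendsto_iff_norm_sub_tendsto_zero]
  have h1 : Tendsto (fun k => √(((S k).realVal f - optValue mbar x r) / (ε / 2))) atTop (𝓝 0) :=
    tendsto_sqrt_div (by simpa using hL.sub_const (optValue mbar x r))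
  refine squeeze_zero' (Eventually.of_forall fun k => norm_nonneg _) ?_ h1
  filter_upwards [hge] with k hk
  exact le_sqrt_div (by positivity) (by linarith [hk i])

end IsGoodRun

end Convergence

end DualAscent

theorem theorem3p3 {V : Type*} [Fintype V] [DecidableEq V] [Nonempty V]
    (E : Finset (V × V)) (hE : StronglyConnected E) (m : ℕ)
    (f : V → Vec m → EReal) (hf : ∀ i, IsClosedProperConvex (f i))
    (xbar : V → Vec m)
    (op : ℕ → Op E) (S : ℕ → State E m) (hrun : IsRun f (mean xbar) op S)
    (ε : ℝ) (hε : 0 < ε) (hs : ∀ k i, ε < (S k).s i)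
    (hz : ∃ M : ℝ, ∀ k i, ‖(S k).z i‖ ≤ M)
    (K : ℕ)
    (hA : ∀ k, ∀ i : V, ∃ l, k ≤ l ∧ l < k + K ∧ op l = Op.A i)
    (hC : ∀ k, ∀ i : V, ∃ l, k ≤ l ∧ l < k + K ∧ op l = Op.C i)
    (hB : ∀ k, ∀ e : E, ∃ l, k ≤ l ∧ l < k + K ∧ op l = Op.B e) :
    (∀ k, ∃ zF : pairs E → ProdSpace E m, Compatible (mean xbar) (S k) zF ∧
      ∀ b : pairs E, none ∈ b.1 → zF b = 0) ∧
    (∀ zF : ℕ → pairs E → ProdSpace E m, (∀ k, Compatible (mean xbar) (S k) (zF k)) →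
      Antitone (fun k => Val f ((S k).tuple (zF k))) ∧
      ∀ s : Idx E → ℝ, IsWeight s →
        Tendsto (fun k => Val f ((S k).tuple (zF k))) atTop
          (𝓝 (dualValue f (mean xbar) s))) ∧
    ∃ xstar : Vec m, primalObj f xbar xstar ≠ ⊤ ∧
      (∀ x, IsMinOn (primalObj f xbar) Set.univ x ↔ x = xstar) ∧
      ∀ i, Tendsto (fun k => (S k).xAll (node i)) atTop (𝓝 xstar) := by
  have h : IsGoodRun f (mean xbar) ε K op S :=
    { hrun with
      connected := hE, convex := hf, pos := hε, weight := hs, bounded := hz, opA := hA, opC := hC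
      opB := hB }
  obtain ⟨x, z, r, hr, hrz, hsum, hval, hx⟩ := h.exists_solution
  refine ⟨fun k => exists_compatible hE (h.inv k), fun zF hzF => ⟨h.antitone_Val hzF,
    fun s hs => ?_⟩, x, ?_⟩
  · rw [dualValue_eq hE f (mean xbar) hs hr hrz hsum]
    refine ((continuous_coe_real_ereal.tendsto _).comp hval).congr' ?_
    -- Before time `K` some conjugate may be infinite and `Val` equal to `⊤`; the identification
    -- with the real potential holds from `K` on.
    filter_upwards [eventually_ge_atTop K] with k hk
    exact (Val_eq_realVal hf (hzF k) (h.isFinite hk)).symm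
  · have hsum' : ∑ i, z i = ∑ i, (xbar i - x) := by
      have hN : (Fintype.card V : ℝ) ≠ 0 := by exact_mod_cast Fintype.card_ne_zero
      rw [hsum, Finset.sum_sub_distrib, smul_sub, mean, smul_inv_smul₀ hN]
      simp [Nat.cast_smul_eq_nsmul]
    have hmin := isMinOn_primalObj_iff f xbar hr hrz hsum'
    exact ⟨hmin.1, hmin.2, hx⟩
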